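/- Let $E$ be a finite-dimensional complex vector space, $g : E \to E$ a linear endomorphism, and $E^g := \ker(g-1)$. Assume that the endomorphism of $E/\ker(g-1)$ induced by $g-1$ is injective. Let $\mathcal{O}[E]$ be the algebra of polynomial functions on $E$, on which $g$ acts by $a \mapsto a\circ g$ (this endomorphism is again denoted $g$), and let $\Omega^q(E^g)$ be the space of algebraic $q$-forms on $E^g$. For a unital complex algebra $A$ with a unital endomorphism $g$, the twisted Hochschild homology $HH_q(A,g)$ is the homology in degree $q \ge 0$ of the complex $A \otimes (A/\mathbb{C}1)^{\otimes n}$, $n \ge 0$, with differential $$b_g(a_0\otimes\cdots\otimes a_n) = a_0 g(a_1)\otimes a_2\otimes\cdots\otimes a_n + \sum_{i=1}^{n-1}(-1)^i a_0\otimes\cdots\otimes a_ia_{i+1}\otimes\cdots\otimes a_n + (-1)^n a_na_0\otimes a_1\otimes\cdots\otimes a_{n-1},$$ and $HH_q(A) := HH_q(A,\mathrm{id})$. Then, for every $q \ge 0$: 1. the restriction $\mathcal{O}[E]\to\mathcal{O}[E^g]$ induces an isomorphism $res_{HH} : HH_q(\mathcal{O}[E],g) \to HH_q(\mathcal{O}[E^g])$;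 2. the Connes–Hochschild–Kostant–Rosenberg map $\chi : HH_q(\mathcal{O}[E^g]) \to \Omega^q(E^g)$ induced by $a_0\otimes\cdots\otimes a_q \mapsto \frac{1}{q!}\,a_0\,da_1\cdots da_q$ is an isomorphism; 3. the twisted map $\chi_g : HH_q(\mathcal{O}[E],g) \to \Omega^q(E^g)$ induced by $a_0\otimes\cdots\otimes a_q \mapsto \frac{1}{q!}\,a_0\,da_1\cdots da_q|_{E^g}$ equals $\chi\circ res_{HH}$ and is an isomorphism. -/

import Mathlib

universe u

namespace TwistedHochschild

noncomputable section

open scoped TensorProduct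
open CategoryTheory

section Complex

/-- The vector space `A / ℂ1`. -/
abbrev Reduced (A : Type u) [Ring A] [Algebra ℂ A] : Type u := A ⧸ (ℂ ∙ (1 : A))

/-- The space `A ⊗ (A / ℂ1)^{⊗ n}` of normalized Hochschild chains of degree `n`. -/
abbrev Chains (A : Type u) [Ring A] [Algebra ℂ A] (n : ℕ) : Type u :=
  A ⊗[ℂ] (⨂[ℂ] _ : Fin n, Reduced A)

variable {A : Type u} [Ring A] [Algebra ℂ A]

/-- The class of `a₀ ⊗ a₁ ⊗ ⋯ ⊗ aₙ` in the normalized chains; the tensor is given as the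
pair `(a₀, (a₁, …, aₙ))`. -/
def chain {n : ℕ} (x : A × (Fin n → A)) : Chains A n :=
  x.1 ⊗ₜ[ℂ] PiTensorProduct.tprod ℂ fun k => (Submodule.Quotient.mk (x.2 k) : Reduced A)

/-- The faces of `a₀ ⊗ a₁ ⊗ ⋯ ⊗ a_{n+1}` (with `x.2 k = a_{k+1}`):
* `face 0` is `a₀ g(a₁) ⊗ a₂ ⊗ ⋯ ⊗ a_{n+1}`;
* `face i`, for `1 ≤ i ≤ n`, is `a₀ ⊗ ⋯ ⊗ a_i a_{i+1} ⊗ ⋯ ⊗ a_{n+1}`;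
* `face (n + 1)` is `a_{n+1} a₀ ⊗ a₁ ⊗ ⋯ ⊗ aₙ`. -/
def face (g : A →ₐ[ℂ] A) {n : ℕ} (i : Fin (n + 2)) (x : A × (Fin (n + 1) → A)) :
    A × (Fin n → A) :=
  (if i = 0 then x.1 * g (x.2 0)
    else if i = Fin.last (n + 1) then x.2 (Fin.last n) * x.1
    else x.1,
   fun k =>
    if (k : ℕ) + 1 < i then x.2 k.castSucc
    else if (k : ℕ) + 1 = i then x.2 k.castSucc * x.2 k.succ
    else x.2 k.succ)

theorem face_update (g : A →ₐ[ℂ] A) {n : ℕ} (i : Fin (n + 2)) (a₀ : A) (a : Fin (n + 1) → A)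
    (m : Fin (n + 1)) :
    (∃ (L : A →ₗ[ℂ] A) (c : Fin n → A), ∀ x, face g i (a₀, Function.update a m x) = (L x, c)) ∨
    (∃ (c₀ : A) (c : Fin n → A) (k : Fin n) (L : A →ₗ[ℂ] A),
      ∀ x, face g i (a₀, Function.update a m x) = (c₀, Function.update c k (L x))) := by
  obtain ⟨i, hi⟩ := i
  obtain ⟨m, hm⟩ := m
  by_cases h0 : i = 0 ∧ m = 0
  · obtain ⟨rfl, rfl⟩ := h0
    refine Or.inl ⟨LinearMap.mulLeft ℂ a₀ ∘ₗ g.toLinearMap, fun k => a k.succ, fun x => ?_⟩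
    ext k
    · simp [face]
    · simp [face, Fin.ext_iff]
  by_cases h1 : i = n + 1 ∧ m = n
  · obtain ⟨rfl, rfl⟩ := h1
    refine Or.inl ⟨LinearMap.mulRight ℂ a₀, fun k => a k.castSucc, fun x => ?_⟩
    ext k
    · simp [face, Function.update_apply, Fin.ext_iff]
    · simp [face, Function.update_apply, Fin.ext_iff, Nat.ne_of_lt]
  refine Or.inr ⟨(face g ⟨i, hi⟩ (a₀, a)).1, (face g ⟨i, hi⟩ (a₀, a)).2, ?_⟩
  have key : ∀ x, (face g ⟨i, hi⟩ (a₀, Function.update a ⟨m, hm⟩ x)).1 =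
      (face g ⟨i, hi⟩ (a₀, a)).1 := by
    intro x
    simp only [face, Function.update_apply, Fin.ext_iff, Fin.val_zero, Fin.val_last]
    grind
  rcases lt_trichotomy i m with h | h | h
  · refine ⟨⟨m - 1, by omega⟩, LinearMap.id, fun x => Prod.ext (key x) ?_⟩
    funext k
    simp only [face, Function.update_apply, Fin.ext_iff, Fin.val_castSucc, Fin.val_succ,
      LinearMap.id_apply]
    grind
  · refine ⟨⟨m - 1, by omega⟩, LinearMap.mulLeft ℂ (a ⟨m - 1, by omega⟩),
      fun x => Prod.ext (key x) ?_⟩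
    funext k
    simp only [face, Function.update_apply, Fin.ext_iff, Fin.val_castSucc, Fin.val_succ,
      LinearMap.mulLeft_apply]
    have : (k : ℕ) = m - 1 → k.castSucc = ⟨m - 1, by omega⟩ := fun h => Fin.ext h
    grind
  · by_cases h' : m + 1 = i
    · refine ⟨⟨m, by omega⟩, LinearMap.mulRight ℂ (a ⟨m + 1, by omega⟩),
        fun x => Prod.ext (key x) ?_⟩
      funext k
      simp only [face, Function.update_apply, Fin.ext_iff, Fin.val_castSucc, Fin.val_succ,
        LinearMap.mulRight_apply]
      have : (k : ℕ) = m → k.succ = ⟨m + 1, by omega⟩ := fun h => Fin.ext (by simp [h])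
      grind
    · refine ⟨⟨m, by omega⟩, LinearMap.id, fun x => Prod.ext (key x) ?_⟩
      funext k
      simp only [face, Function.update_apply, Fin.ext_iff, Fin.val_castSucc, Fin.val_succ,
        LinearMap.id_apply]
      grind

theorem face_face (g : A →ₐ[ℂ] A) {n : ℕ} (i : Fin (n + 2)) (j : Fin (n + 3))
    (h : (j : ℕ) ≤ i) (x : A × (Fin (n + 2) → A)) :
    face g i (face g j x) =
      face g (Fin.castLT j (lt_of_le_of_lt h i.2)) (face g i.succ x) := by
  obtain ⟨i, hi⟩ := i
  obtain ⟨j, hj⟩ := j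
  obtain ⟨a₀, a⟩ := x
  obtain ⟨b, rfl⟩ : ∃ b : ℕ → A, a = fun k => b k.1 :=
    ⟨fun k => if hk : k < n + 2 then a ⟨k, hk⟩ else 0, by funext k; dsimp only; rw [dif_pos k.2]⟩
  simp only [] at h
  refine Prod.ext ?_ ?_
  · simp only [face, Fin.ext_iff, Fin.val_zero, Fin.val_last, Fin.val_castSucc, Fin.val_succ,
      Fin.val_castLT, Fin.succ_mk]
    rcases Nat.eq_zero_or_pos j with rfl | hj0
    · rcases Nat.eq_zero_or_pos i with rfl | hi0
      · simp [mul_assoc]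
      · by_cases hl : i = n + 1
        · subst hl
          simp [mul_assoc]
        · grind
    · by_cases hl : i = n + 1
      · subst hl
        by_cases hj1 : j = n + 1
        · subst hj1; simp [mul_assoc]
        · grind
      · grind
  · funext k
    simp only [face, Fin.ext_iff, Fin.val_zero, Fin.val_last, Fin.val_castSucc, Fin.val_succ,
      Fin.val_castLT, Fin.succ_mk]
    grind [mul_assoc]

theorem chain_update_add {n : ℕ} (a₀ : A) (c : Fin n → A) (k : Fin n) (x y : A) :
    chain (a₀, Function.update c k (x + y)) =
      chain (a₀, Function.update c k x) + chain (a₀, Function.update c k y) := by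
  have h : ∀ z, (fun j => (Submodule.Quotient.mk (Function.update c k z j) : Reduced A)) =
      Function.update (fun j => Submodule.Quotient.mk (c j)) k (Submodule.Quotient.mk z) := by
    intro z; funext j; by_cases hj : j = k <;> simp [hj]
  simp [chain, h, TensorProduct.tmul_add]

theorem chain_update_smul {n : ℕ} (a₀ : A) (c : Fin n → A) (k : Fin n) (r : ℂ) (x : A) :
    chain (a₀, Function.update c k (r • x)) = r • chain (a₀, Function.update c k x) := by
  have h : ∀ z, (fun j => (Submodule.Quotient.mk (Function.update c k z j) : Reduced A)) =
      Function.update (fun j => Submodule.Quotient.mk (c j)) k (Submodule.Quotient.mk z) := by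
    intro z; funext j; by_cases hj : j = k <;> simp [hj]
  simp [chain, h]

theorem chain_eq_zero {n : ℕ} (x : A × (Fin n → A)) (k : Fin n) (h : x.2 k = 1) :
    chain x = 0 := by
  have : (PiTensorProduct.tprod ℂ fun k => (Submodule.Quotient.mk (x.2 k) : Reduced A)) = 0 := by
    refine MultilinearMap.map_coord_zero _ k ?_
    rw [h, Submodule.Quotient.mk_eq_zero]
    exact Submodule.mem_span_singleton_self 1
  rw [chain, this, TensorProduct.tmul_zero]

/-- The multilinear form `(a₁, …, a_{n+1}) ↦ (a₀ ↦ b_g (a₀ ⊗ a₁ ⊗ ⋯ ⊗ a_{n+1}))` of the twisted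
Hochschild boundary `b_g = ∑ᵢ (-1)ⁱ face i`. -/
def boundaryMulti (g : A →ₐ[ℂ] A) (n : ℕ) :
    MultilinearMap ℂ (fun _ : Fin (n + 1) => A) (A →ₗ[ℂ] Chains A n) where
  toFun a :=
    { toFun := fun a₀ => ∑ i : Fin (n + 2), (-1 : ℂ) ^ (i : ℕ) • chain (face g i (a₀, a))
      map_add' := by
        intro x y
        rw [← Finset.sum_add_distrib]
        refine Finset.sum_congr rfl fun i _ => ?_
        rw [← smul_add]
        congr 1
        simp only [chain, face]
        split_ifs <;> simp [add_mul, mul_add, TensorProduct.add_tmul]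
      map_smul' := by
        intro r x
        rw [Finset.smul_sum]
        refine Finset.sum_congr rfl fun i _ => ?_
        rw [RingHom.id_apply, smul_comm r]
        congr 1
        simp only [chain, face]
        split_ifs <;> simp [TensorProduct.smul_tmul'] }
  map_update_add' := by
    intro inst a m x y
    obtain rfl : inst = instDecidableEqFin _ := Subsingleton.elim _ _
    ext a₀
    simp only [LinearMap.coe_mk, AddHom.coe_mk, LinearMap.add_apply]
    rw [← Finset.sum_add_distrib]
    refine Finset.sum_congr rfl fun i _ => ?_
    rw [← smul_add]
    congr 1
    rcases face_update g i a₀ a m with ⟨L, c, h⟩ | ⟨c₀, c, k, L, h⟩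
    · simp only [h, map_add, chain, TensorProduct.add_tmul]
    · simp only [h, map_add, chain_update_add]
  map_update_smul' := by
    intro inst a m r x
    obtain rfl : inst = instDecidableEqFin _ := Subsingleton.elim _ _
    ext a₀
    simp only [LinearMap.coe_mk, AddHom.coe_mk, LinearMap.smul_apply]
    rw [Finset.smul_sum]
    refine Finset.sum_congr rfl fun i _ => ?_
    rw [smul_comm r]
    congr 1
    rcases face_update g i a₀ a m with ⟨L, c, h⟩ | ⟨c₀, c, k, L, h⟩
    · simp only [h, map_smul, chain, TensorProduct.smul_tmul']
    · simp only [h, map_smul, chain_update_smul]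

theorem boundaryMulti_apply (g : A →ₐ[ℂ] A) (n : ℕ) (a : Fin (n + 1) → A) (a₀ : A) :
    boundaryMulti g n a a₀ =
      ∑ i : Fin (n + 2), (-1 : ℂ) ^ (i : ℕ) • chain (face g i (a₀, a)) := rfl

theorem boundaryMulti_eq_zero (g : A →ₐ[ℂ] A) (n : ℕ) (a : Fin (n + 1) → A) (m : Fin (n + 1))
    (h : a m ∈ (ℂ ∙ (1 : A))) : boundaryMulti g n a = 0 := by
  obtain ⟨r, hr⟩ := Submodule.mem_span_singleton.1 h
  have ha : a = Function.update a m (r • (1 : A)) := by rw [hr, Function.update_eq_self]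
  rw [ha, MultilinearMap.map_update_smul]
  have h1 : Function.update a m (1 : A) m = 1 := by simp
  generalize Function.update a m (1 : A) = c at h1
  suffices boundaryMulti g n c = 0 by rw [this, smul_zero]
  ext a₀
  rw [boundaryMulti_apply, LinearMap.zero_apply]
  have hne : m.castSucc ≠ m.succ := by simp [Fin.ext_iff]
  rw [← Finset.sum_subset (Finset.subset_univ {m.castSucc, m.succ}), Finset.sum_pair hne]
  · have : face g m.castSucc (a₀, c) = face g m.succ (a₀, c) := by
      obtain ⟨m, hm⟩ := m
      obtain ⟨b, rfl⟩ : ∃ b : ℕ → A, c = fun k => b k.1 :=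
        ⟨fun k => if hk : k < n + 1 then c ⟨k, hk⟩ else 0, by funext k; dsimp only; rw [dif_pos k.2]⟩
      simp only [] at h1
      refine Prod.ext ?_ ?_
      · simp only [face, Fin.ext_iff, Fin.val_zero, Fin.val_last, Fin.val_castSucc, Fin.val_succ]
        grind
      · funext k
        simp only [face, Fin.ext_iff, Fin.val_zero, Fin.val_last, Fin.val_castSucc, Fin.val_succ]
        grind
    rw [this, ← add_smul]
    simp [pow_succ]
  · intro i _ hi
    simp only [Finset.mem_insert, Finset.mem_singleton, not_or, Fin.ext_iff, Fin.val_castSucc,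
      Fin.val_succ] at hi
    obtain ⟨m, hm⟩ := m
    obtain ⟨i, hi'⟩ := i
    simp only [] at hi
    have : chain (face g ⟨i, hi'⟩ (a₀, c)) = 0 := by
      by_cases him : i < m
      · refine chain_eq_zero _ ⟨m - 1, by omega⟩ ?_
        have e : (⟨m - 1, by omega⟩ : Fin n).succ = ⟨m, hm⟩ := by
          simp only [Fin.succ_mk, Fin.mk.injEq]; omega
        simp only [face, e, h1]
        rw [if_neg (by omega), if_neg (by omega)]
      · refine chain_eq_zero _ ⟨m, by omega⟩ ?_
        have e : (⟨m, by omega⟩ : Fin n).castSucc = ⟨m, hm⟩ := rfl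
        simp only [face, e, h1]
        rw [if_pos (by omega)]
    rw [this, smul_zero]

theorem multilinear_congr {n : ℕ} {N : Type*} [AddCommMonoid N] [Module ℂ N]
    (S : Submodule ℂ A) (f : MultilinearMap ℂ (fun _ : Fin n => A) N)
    (hf : ∀ a i, a i ∈ S → f a = 0) (a c : Fin n → A) (h : ∀ i, a i - c i ∈ S) : f a = f c := by
  have key : ∀ s : Finset (Fin n), f (s.piecewise a c) = f c := by
    intro s
    induction s using Finset.induction_on with
    | empty => simp
    | insert j s hj ih =>
      rw [Finset.piecewise_insert]
      have e : a j = (a j - c j) + (s.piecewise a c) j := by simp [hj]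
      rw [e, MultilinearMap.map_update_add, Function.update_eq_self, ih,
        hf _ j (by simpa using h j), zero_add]
  simpa using key Finset.univ

/-- A multilinear map that vanishes as soon as one argument lies in `S` descends to the
quotient by `S` in every argument. -/
def descend {n : ℕ} {N : Type*} [AddCommMonoid N] [Module ℂ N]
    (S : Submodule ℂ A) (f : MultilinearMap ℂ (fun _ : Fin n => A) N)
    (hf : ∀ a i, a i ∈ S → f a = 0) : MultilinearMap ℂ (fun _ : Fin n => A ⧸ S) N where
  toFun v := f fun k => (v k).out
  map_update_add' := by
    intro inst v m x y
    obtain rfl : inst = instDecidableEqFin _ := Subsingleton.elim _ _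
    have h : ∀ z : A ⧸ S, ∀ w : A, Submodule.Quotient.mk w = z →
        f (fun k => (Function.update v m z k).out) =
          f (Function.update (fun k => (v k).out) m w) := by
      intro z w hw
      refine multilinear_congr S f hf _ _ fun i => ?_
      rw [← Submodule.Quotient.eq]
      by_cases hi : i = m
      · subst hi; simpa using hw.symm
      · simp [hi]
    rw [h _ (x.out + y.out) (by simp), h x x.out (by simp), h y y.out (by simp),
      MultilinearMap.map_update_add]
  map_update_smul' := by
    intro inst v m r x
    obtain rfl : inst = instDecidableEqFin _ := Subsingleton.elim _ _
    have h : ∀ z : A ⧸ S, ∀ w : A, Submodule.Quotient.mk w = z →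
        f (fun k => (Function.update v m z k).out) =
          f (Function.update (fun k => (v k).out) m w) := by
      intro z w hw
      refine multilinear_congr S f hf _ _ fun i => ?_
      rw [← Submodule.Quotient.eq]
      by_cases hi : i = m
      · subst hi; simpa using hw.symm
      · simp [hi]
    rw [h _ (r • x.out) (by simp), h x x.out (by simp), MultilinearMap.map_update_smul]

theorem descend_mk {n : ℕ} {N : Type*} [AddCommMonoid N] [Module ℂ N]
    (S : Submodule ℂ A) (f : MultilinearMap ℂ (fun _ : Fin n => A) N)
    (hf : ∀ a i, a i ∈ S → f a = 0) (a : Fin n → A) :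
    descend S f hf (fun k => Submodule.Quotient.mk (a k)) = f a := by
  refine multilinear_congr S f hf _ _ fun i => ?_
  rw [← Submodule.Quotient.eq]
  simp

/-- The twisted Hochschild boundary `b_g : A ⊗ (A/ℂ1)^{⊗ (n+1)} → A ⊗ (A/ℂ1)^{⊗ n}`; its values
on tensors are given by `boundary_chain`. -/
def boundary (g : A →ₐ[ℂ] A) (n : ℕ) : Chains A (n + 1) →ₗ[ℂ] Chains A n :=
  TensorProduct.lift (PiTensorProduct.lift
    (descend (ℂ ∙ (1 : A)) (boundaryMulti g n) (boundaryMulti_eq_zero g n))).flip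

theorem boundary_chain (g : A →ₐ[ℂ] A) (n : ℕ) (x : A × (Fin (n + 1) → A)) :
    boundary g n (chain x) =
      ∑ i : Fin (n + 2), (-1 : ℂ) ^ (i : ℕ) • chain (face g i x) := by
  simp only [boundary, chain, TensorProduct.lift.tmul, LinearMap.flip_apply,
    PiTensorProduct.lift.tprod, descend_mk]
  rfl

/-- Two linear maps on normalized chains agree if they agree on all `a₀ ⊗ ⋯ ⊗ aₙ`. -/
theorem chains_ext {n : ℕ} {N : Type*} [AddCommMonoid N] [Module ℂ N]
    {f f' : Chains A n →ₗ[ℂ] N} (h : ∀ x : A × (Fin n → A), f (chain x) = f' (chain x)) :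
    f = f' := by
  refine TensorProduct.ext (LinearMap.ext fun a₀ => PiTensorProduct.ext
    (MultilinearMap.ext fun v => ?_))
  have := h (a₀, fun k => (v k).out)
  simpa [chain] using this

theorem boundary_boundary (g : A →ₐ[ℂ] A) (n : ℕ) :
    boundary g n ∘ₗ boundary g (n + 1) = 0 := by
  refine chains_ext fun x => ?_
  simp only [LinearMap.comp_apply, boundary_chain, map_sum, map_smul, LinearMap.zero_apply,
    Finset.smul_sum, smul_smul, ← pow_add]
  rw [Finset.sum_comm, ← Finset.sum_product']
  let S : Finset (Fin (n + 2) × Fin (n + 3)) := {ij | (ij.2 : ℕ) ≤ (ij.1 : ℕ)}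
  rw [Finset.univ_product_univ, ← Finset.sum_add_sum_compl S, ← eq_neg_iff_add_eq_zero,
    ← Finset.sum_neg_distrib]
  refine Finset.sum_bij (fun ij hij => (Fin.castLT ij.2
    (lt_of_le_of_lt (Finset.mem_filter.mp hij).right (Fin.is_lt ij.1)), ij.1.succ)) ?_ ?_ ?_ ?_
  · intro ij hij
    simp only [S, Finset.mem_filter_univ, Finset.mem_compl, Fin.val_succ, Fin.val_castLT] at hij ⊢
    omega
  · rintro ⟨i, j⟩ hij ⟨i', j'⟩ hij' h
    simp only [Prod.mk.injEq, Fin.ext_iff, Fin.val_castLT, Fin.val_succ] at h ⊢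
    omega
  · rintro ⟨i', j'⟩ hij'
    simp only [S, Finset.mem_compl, Finset.mem_filter_univ, not_le] at hij'
    refine ⟨(⟨j' - 1, by omega⟩, i'.castSucc), ?_, ?_⟩
    · simp only [S, Finset.mem_filter_univ, Fin.val_castSucc]; omega
    · simp only [Prod.mk.injEq, Fin.ext_iff, Fin.val_castLT, Fin.val_succ, Fin.val_castSucc,
        true_and]
      omega
  · rintro ⟨i, j⟩ hij
    have hij' : (j : ℕ) ≤ i := by simpa [S] using hij
    simp only [Fin.val_succ, Fin.val_castLT]
    rw [face_face g i j hij', ← neg_smul]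
    congr 1
    ring

/-- The complex `(A ⊗ (A/ℂ1)^{⊗ n}, b_g)_{n ≥ 0}`. -/
def hochschildComplex (A : Type u) [Ring A] [Algebra ℂ A] (g : A →ₐ[ℂ] A) :
    ChainComplex (ModuleCat.{u} ℂ) ℕ :=
  ChainComplex.of (fun n => ModuleCat.of ℂ (Chains A n)) (fun n => ModuleCat.ofHom (boundary g n))
    fun n => by rw [← ModuleCat.ofHom_comp, boundary_boundary, ModuleCat.ofHom_zero]

theorem hochschildComplex_d (g : A →ₐ[ℂ] A) (n : ℕ) :
    (hochschildComplex A g).d (n + 1) n = ModuleCat.ofHom (boundary g n) := by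
  unfold hochschildComplex
  exact ChainComplex.of_d (fun n => ModuleCat.of ℂ (Chains A n))
    (fun n => ModuleCat.ofHom (boundary g n)) n

/-- The `g`-twisted Hochschild homology `HH_q(A, g)`. -/
abbrev HH (A : Type u) [Ring A] [Algebra ℂ A] (g : A →ₐ[ℂ] A) (q : ℕ) : ModuleCat.{u} ℂ :=
  (hochschildComplex A g).homology q

end Complex

section Functoriality

variable {A B : Type u} [Ring A] [Algebra ℂ A] [Ring B] [Algebra ℂ B]

/-- The map `A/ℂ1 → B/ℂ1` induced by an algebra morphism. -/
def reducedMap (φ : A →ₐ[ℂ] B) : Reduced A →ₗ[ℂ] Reduced B :=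
  Submodule.mapQ _ _ φ.toLinearMap (by
    rw [Submodule.span_singleton_le_iff_mem, Submodule.mem_comap, AlgHom.toLinearMap_apply,
      map_one]
    exact Submodule.mem_span_singleton_self 1)

/-- The map `a₀ ⊗ ⋯ ⊗ aₙ ↦ φ(a₀) ⊗ ⋯ ⊗ φ(aₙ)` on normalized chains. -/
def chainsMap (φ : A →ₐ[ℂ] B) (n : ℕ) : Chains A n →ₗ[ℂ] Chains B n :=
  TensorProduct.map φ.toLinearMap (PiTensorProduct.map fun _ => reducedMap φ)

theorem chainsMap_chain (φ : A →ₐ[ℂ] B) {n : ℕ} (x : A × (Fin n → A)) :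
    chainsMap φ n (chain x) = chain (φ x.1, fun k => φ (x.2 k)) := by
  simp [chainsMap, chain, reducedMap]

theorem chainsMap_boundary (φ : A →ₐ[ℂ] B) (g : A →ₐ[ℂ] A) (h : B →ₐ[ℂ] B)
    (hφ : φ.comp g = h.comp φ) (n : ℕ) :
    boundary h n ∘ₗ chainsMap φ (n + 1) = chainsMap φ n ∘ₗ boundary g n := by
  refine chains_ext fun x => ?_
  have hφ' : ∀ a, h (φ a) = φ (g a) := fun a => (DFunLike.congr_fun hφ a).symm
  simp only [LinearMap.comp_apply, chainsMap_chain, boundary_chain, map_sum, map_smul]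
  refine Finset.sum_congr rfl fun i _ => ?_
  congr 2
  refine Prod.ext ?_ (funext fun k => ?_)
  · simp only [face, hφ']
    split_ifs <;> simp
  · simp only [face]
    split_ifs <;> simp

/-- The chain map of twisted Hochschild complexes induced by an algebra morphism `φ` that
intertwines the twisting endomorphisms. -/
def complexMap (φ : A →ₐ[ℂ] B) (g : A →ₐ[ℂ] A) (h : B →ₐ[ℂ] B) (hφ : φ.comp g = h.comp φ) :
    hochschildComplex A g ⟶ hochschildComplex B h :=
  ChainComplex.ofHom (fun n => ModuleCat.ofHom (chainsMap φ n)) fun n => by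
    rw [hochschildComplex_d, hochschildComplex_d]
    exact congrArg ModuleCat.ofHom (chainsMap_boundary φ g h hφ n)

/-- The map `HH_q(A, g) → HH_q(B, h)` induced by `φ`. -/
def mapHH (φ : A →ₐ[ℂ] B) (g : A →ₐ[ℂ] A) (h : B →ₐ[ℂ] B) (hφ : φ.comp g = h.comp φ) (q : ℕ) :
    HH A g q ⟶ HH B h q :=
  HomologicalComplex.homologyMap (complexMap φ g h hφ) q

end Functoriality

section HKR

/-- The algebraic `q`-forms of the affine variety with coordinate ring `B`: the `q`-th exterior
power over `B` of the Kähler differentials of `B` over `ℂ`. -/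
abbrev Forms (B : Type u) [CommRing B] [Algebra ℂ B] (q : ℕ) : Type u := ⋀[B]^q (Ω[B⁄ℂ])

variable {A B : Type u} [CommRing A] [Algebra ℂ A] [CommRing B] [Algebra ℂ B]

/-- The map `A/ℂ1 → Ω¹_B`, `a ↦ d(φ a)`. -/
def reducedD (φ : A →ₐ[ℂ] B) : Reduced A →ₗ[ℂ] Ω[B⁄ℂ] :=
  Submodule.liftQ _ ((KaehlerDifferential.D ℂ B).toLinearMap ∘ₗ φ.toLinearMap) (by
    rw [Submodule.span_singleton_le_iff_mem, LinearMap.mem_ker]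
    simp)

/-- The map `a₀ ⊗ a₁ ⊗ ⋯ ⊗ aₙ ↦ (1 / n!) φ(a₀) dφ(a₁) ∧ ⋯ ∧ dφ(aₙ)`. -/
def chiChains (φ : A →ₐ[ℂ] B) (n : ℕ) : Chains A n →ₗ[ℂ] Forms B n :=
  (n.factorial : ℂ)⁻¹ •
    TensorProduct.lift
      (((LinearMap.lsmul B (Forms B n)).restrictScalars₁₂ ℂ ℂ).compl₁₂ φ.toLinearMap
        (PiTensorProduct.lift
          (((exteriorPower.ιMulti B n (M := Ω[B⁄ℂ])).toMultilinearMap.restrictScalars ℂ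
            ).compLinearMap fun _ => reducedD φ)))

theorem chiChains_chain (φ : A →ₐ[ℂ] B) {n : ℕ} (x : A × (Fin n → A)) :
    chiChains φ n (chain x) =
      (n.factorial : ℂ)⁻¹ • φ x.1 •
        exteriorPower.ιMulti B n fun k => KaehlerDifferential.D ℂ B (φ (x.2 k)) := by
  simp [chiChains, chain, reducedD]

theorem chiChains_face (φ : A →ₐ[ℂ] B) (g : A →ₐ[ℂ] A) (hφ : φ.comp g = φ) (n : ℕ)
    (x : A × (Fin (n + 1) → A)) (G : ℕ → Forms B n)
    (hG : ∀ k : Fin (n + 1), G (k + 1) = (φ x.1 * φ (x.2 k)) •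
      exteriorPower.ιMulti B n fun j => KaehlerDifferential.D ℂ B (φ (x.2 (k.succAbove j))))
    (h0 : G 0 = 0) (h1 : G (n + 2) = 0) (i : Fin (n + 2)) :
    φ (face g i x).1 • exteriorPower.ιMulti B n (fun k => KaehlerDifferential.D ℂ B
      (φ ((face g i x).2 k))) = G i + G (i + 1) := by
  have hφ' : ∀ a, φ (g a) = φ a := fun a => DFunLike.congr_fun hφ a
  by_cases hi0 : i = 0
  · subst hi0
    have := hG 0
    simp only [Fin.val_zero, zero_add] at this ⊢
    rw [h0, this, zero_add]
    simp [face, hφ']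
  by_cases hi1 : i = Fin.last (n + 1)
  · subst hi1
    have := hG (Fin.last n)
    simp only [Fin.val_last] at this ⊢
    rw [h1, this, add_zero]
    simp [face, mul_comm]
  obtain ⟨i, hi⟩ := i
  have hi0' : i ≠ 0 := fun h => hi0 (Fin.ext h)
  have hi1' : i ≠ n + 1 := fun h => hi1 (Fin.ext h)
  obtain ⟨m, rfl⟩ := Nat.exists_eq_succ_of_ne_zero hi0'
  have hm : m < n := by omega
  have e0 := hG ⟨m, by omega⟩
  have e1 := hG ⟨m + 1, by omega⟩
  simp only [Nat.succ_eq_add_one] at e0 e1 ⊢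
  rw [e0, e1]
  set k : Fin n := ⟨m, hm⟩ with hk
  have hf1 : (face g ⟨m + 1, hi⟩ x).1 = x.1 := by
    simp [face, Fin.ext_iff]
    omega
  let c : Fin n → Ω[B⁄ℂ] := fun j => KaehlerDifferential.D ℂ B (φ ((face g ⟨m + 1, hi⟩ x).2 j))
  have hc : ∀ j, c j = KaehlerDifferential.D ℂ B (φ ((face g ⟨m + 1, hi⟩ x).2 j)) := fun _ => rfl
  have hck : c k = φ (x.2 k.castSucc) • KaehlerDifferential.D ℂ B (φ (x.2 k.succ)) +
      φ (x.2 k.succ) • KaehlerDifferential.D ℂ B (φ (x.2 k.castSucc)) := by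
    simp [hc, face, hk]
  have hcu : (fun j => KaehlerDifferential.D ℂ B (φ ((face g ⟨m + 1, hi⟩ x).2 j))) =
      Function.update c k (c k) := by rw [Function.update_eq_self]
  have hs : ∀ (t : Fin (n + 1)) (s : Fin (n + 1)), (t = k.castSucc ∧ s = k.succ) ∨
      (t = k.succ ∧ s = k.castSucc) →
      Function.update c k (KaehlerDifferential.D ℂ B (φ (x.2 s))) =
        fun j => KaehlerDifferential.D ℂ B (φ (x.2 (t.succAbove j))) := by
    intro t s hts
    funext j
    by_cases hj : j = k
    · subst hj
      rcases hts with ⟨rfl, rfl⟩ | ⟨rfl, rfl⟩ <;> simp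
    · have hj' : (j : ℕ) ≠ m := fun h => hj (Fin.ext h)
      rw [Function.update_of_ne hj, hc]
      congr 3
      simp only [face]
      rcases hts with ⟨rfl, rfl⟩ | ⟨rfl, rfl⟩ <;>
        simp only [Fin.succAbove, Fin.lt_def, Fin.val_castSucc, Fin.val_succ, hk] <;>
        split_ifs <;> first | rfl | omega
  rw [hf1, hcu, hck, AlternatingMap.map_update_add, AlternatingMap.map_update_smul,
    AlternatingMap.map_update_smul, hs k.castSucc k.succ (Or.inl ⟨rfl, rfl⟩),
    hs k.succ k.castSucc (Or.inr ⟨rfl, rfl⟩), smul_add, smul_smul, smul_smul]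
  rfl

theorem alternating_telescope {N : Type*} [AddCommGroup N] [Module ℂ N] (G : ℕ → N) (n : ℕ) :
    ∑ i ∈ Finset.range n, (-1 : ℂ) ^ i • (G i + G (i + 1)) = G 0 - (-1 : ℂ) ^ n • G n := by
  induction n with
  | zero => simp
  | succ n ih =>
    rw [Finset.sum_range_succ, ih, pow_succ, smul_add, mul_neg_one, neg_smul]
    abel

theorem chiChains_boundary (φ : A →ₐ[ℂ] B) (g : A →ₐ[ℂ] A) (hφ : φ.comp g = φ) (n : ℕ) :
    chiChains φ n ∘ₗ boundary g n = 0 := by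
  refine chains_ext fun x => ?_
  simp only [LinearMap.comp_apply, boundary_chain, map_sum, map_smul, chiChains_chain,
    LinearMap.zero_apply]
  simp only [smul_comm _ ((n.factorial : ℂ)⁻¹)]
  rw [← Finset.smul_sum]
  let G : ℕ → Forms B n := fun k => if h : k ≠ 0 ∧ k < n + 2 then
    (φ x.1 * φ (x.2 ⟨k - 1, by omega⟩)) • exteriorPower.ιMulti B n fun j =>
      KaehlerDifferential.D ℂ B (φ (x.2 ((⟨k - 1, by omega⟩ : Fin (n + 1)).succAbove j))) else 0
  have h0 : G 0 = 0 := by simp [G]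
  have h1 : G (n + 2) = 0 := by simp [G]
  have hG : ∀ k : Fin (n + 1), G (k + 1) = (φ x.1 * φ (x.2 k)) •
      exteriorPower.ιMulti B n fun j => KaehlerDifferential.D ℂ B (φ (x.2 (k.succAbove j))) := by
    intro k
    exact dif_pos ⟨Nat.succ_ne_zero _, by omega⟩
  simp only [chiChains_face φ g hφ n x G hG h0 h1]
  rw [Fin.sum_univ_eq_sum_range (fun i => (-1 : ℂ) ^ i • (G i + G (i + 1))),
    alternating_telescope, h0, h1]
  simp

/-- The map `chiChains φ q`, as a morphism out of the degree `q` term of the complex. -/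
def chiHom (φ : A →ₐ[ℂ] B) (g : A →ₐ[ℂ] A) (q : ℕ) :
    (hochschildComplex A g).X q ⟶ ModuleCat.of ℂ (Forms B q) :=
  ModuleCat.ofHom (X := Chains A q) (chiChains φ q)

/-- The twisted Connes–Hochschild–Kostant–Rosenberg map `HH_q(A, g) → Ω^q_B` attached to an
algebra morphism `φ : A → B` with `φ ∘ g = φ`; on cycles it is given by `chiChains`, see
`homologyπ_chi`. -/
def chi (φ : A →ₐ[ℂ] B) (g : A →ₐ[ℂ] A) (hφ : φ.comp g = φ) (q : ℕ) :
    HH A g q ⟶ ModuleCat.of ℂ (Forms B q) :=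
  (hochschildComplex A g).homologyι q ≫
    (hochschildComplex A g).descOpcycles (chiHom φ g q) (q + 1) (by simp) (by
      rw [hochschildComplex_d]
      exact congrArg ModuleCat.ofHom (chiChains_boundary φ g hφ q))

theorem homologyπ_chi (φ : A →ₐ[ℂ] B) (g : A →ₐ[ℂ] A) (hφ : φ.comp g = φ) (q : ℕ) :
    (hochschildComplex A g).homologyπ q ≫ chi φ g hφ q =
      (hochschildComplex A g).iCycles q ≫ chiHom φ g q := by
  rw [chi, HomologicalComplex.homology_π_ι_assoc]
  exact congrArg _ (HomologicalComplex.p_descOpcycles _ _ _ _ _)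

end HKR

section Linear

/-- The ring `𝒪[E]` of polynomial functions on `E`: the algebra of functions generated by the
linear forms. -/
def polyFun (E : Type u) [AddCommGroup E] [Module ℂ E] : Subalgebra ℂ (E → ℂ) :=
  Algebra.adjoin ℂ (Set.range fun ξ : Module.Dual ℂ E => (ξ : E → ℂ))

variable {E F : Type u} [AddCommGroup E] [Module ℂ E] [AddCommGroup F] [Module ℂ F]

/-- Composition with a linear map `l : F → E`, as a morphism `𝒪[E] → 𝒪[F]`, `p ↦ p ∘ l`. -/
def pullback (l : F →ₗ[ℂ] E) : polyFun E →ₐ[ℂ] polyFun F :=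
  AlgHom.codRestrict
    ((AlgHom.pi fun v => Pi.evalAlgHom ℂ (fun _ : E => ℂ) (l v)).comp
      (polyFun E).val)
    (polyFun F) (by
      rintro ⟨p, hp⟩
      have h : polyFun E ≤ (polyFun F).comap
          (AlgHom.pi fun v => Pi.evalAlgHom ℂ (fun _ : E => ℂ) (l v)) := by
        refine Algebra.adjoin_le ?_
        rintro _ ⟨ξ, rfl⟩
        exact Algebra.subset_adjoin ⟨ξ ∘ₗ l, rfl⟩
      exact h hp)

theorem pullback_apply (l : F →ₗ[ℂ] E) (p : polyFun E) (v : F) :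
    (pullback l p : F → ℂ) v = (p : E → ℂ) (l v) := rfl

/-- The fixed space `E^g = ker (g - 1)`. -/
abbrev fixedSpace (g : E →ₗ[ℂ] E) : Submodule ℂ E := LinearMap.ker (g - LinearMap.id)

/-- The endomorphism of `E / ker (g - 1)` induced by `g - 1`. -/
def quotientMap (g : E →ₗ[ℂ] E) : (E ⧸ fixedSpace g) →ₗ[ℂ] (E ⧸ fixedSpace g) :=
  Submodule.mapQ (fixedSpace g) (fixedSpace g) (g - LinearMap.id) fun v hv => by
    rw [Submodule.mem_comap, LinearMap.mem_ker.1 hv]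
    exact zero_mem _

/-- The restriction `𝒪[E] → 𝒪[E^g]`. -/
def restriction (g : E →ₗ[ℂ] E) : polyFun E →ₐ[ℂ] polyFun (fixedSpace g) :=
  pullback (fixedSpace g).subtype

theorem restriction_comp (g : E →ₗ[ℂ] E) :
    (restriction g).comp (pullback g) = restriction g := by
  refine AlgHom.ext fun p => Subtype.ext (funext fun v => ?_)
  have h : g v = v := sub_eq_zero.1 (LinearMap.mem_ker.1 v.2)
  change (p : E → ℂ) (g v) = (p : E → ℂ) v
  rw [h]

/-- The map `HH_q(𝒪[E], g) → HH_q(𝒪[E^g])` induced by restriction, where `g` acts on `𝒪[E]`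
by `p ↦ p ∘ g`. -/
def resHH (g : E →ₗ[ℂ] E) (q : ℕ) :
    HH (polyFun E) (pullback g) q ⟶ HH (polyFun (fixedSpace g)) (AlgHom.id ℂ _) q :=
  mapHH (restriction g) (pullback g) (AlgHom.id ℂ _)
    ((restriction_comp g).trans (AlgHom.id_comp _).symm) q

/-- The twisted Connes–Hochschild–Kostant–Rosenberg map `χ_g : HH_q(𝒪[E], g) → Ω^q(E^g)`,
`a₀ ⊗ ⋯ ⊗ a_q ↦ (1 / q!) a₀ da₁ ∧ ⋯ ∧ da_q |_{E^g}`. -/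
def chiTwisted (g : E →ₗ[ℂ] E) (q : ℕ) :
    HH (polyFun E) (pullback g) q ⟶ ModuleCat.of ℂ (Forms (polyFun (fixedSpace g)) q) :=
  chi (restriction g) (pullback g) (restriction_comp g) q

/-- The Connes–Hochschild–Kostant–Rosenberg map `χ : HH_q(𝒪[E]) → Ω^q(E)`,
`a₀ ⊗ ⋯ ⊗ a_q ↦ (1 / q!) a₀ da₁ ∧ ⋯ ∧ da_q`. -/
def chiUntwisted (E : Type u) [AddCommGroup E] [Module ℂ E] (q : ℕ) :
    HH (polyFun E) (AlgHom.id ℂ _) q ⟶ ModuleCat.of ℂ (Forms (polyFun E) q) :=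
  chi (AlgHom.id ℂ _) (AlgHom.id ℂ _) (AlgHom.id_comp _) q

end Linear

end

end TwistedHochschild

/-! Twisted Hochschild homology of $A=\mathcal{O}[E]$ is Hochschild homology with coefficients in
$A$, the right action being twisted by $g$. For coordinates $x_i$ and any bimodule, a Koszul complex
of alternating forms maps to the Hochschild complex by antisymmetrization; its operators are
$m\mapsto m x_i-x_i m$, here multiplication by $g(x_i)-x_i$.

Injectivity of $g-1$ on the quotient gives $E=\ker(g-1)\oplus\mathrm{im}(g-1)$. In coordinates
adapted to this splitting, the Koszul operators vanish in the fixed directions and are linear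
coordinates in the transversal ones. Cartan's formula with an Euler field then contracts the
transversal directions, leaving forms on $E^g$.

Three facts give the isomorphism. By `exists_antisymm_of_cycle` every Hochschild cycle of positive
degree is, up to a boundary, the antisymmetrization of a Koszul cycle (dimension shifting along
$0\to M\otimes A/\mathbb{C}\to A\otimes M\to M\to 0$, whose middle term is Koszul acyclic by
`freeOp_exact`). By `IsAdapted.exists_reduced` that Koszul cycle may be taken constant along the
transversal directions and free of their differentials. By `IsAdapted.eq_zero_of_chiChains` the HKR
map detects such a cycle. So $\chi_g$ is injective, and explicit Koszul cycles give surjectivity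
(`IsAdapted.exists_cycle`). Injectivity of antisymmetrization on homology is never needed, because
$\chi_g$ kills boundaries.

The untwisted statement on $E^g$ is the same theorem with no transversal directions; since
$\chi_g=\chi\circ res_{HH}$ already on chains, $res_{HH}$ is an isomorphism by two-out-of-three. -/

namespace TwistedHochschild

noncomputable section

open scoped TensorProduct
open CategoryTheory

/-! ### Koszul differentials, Cartan's formula and the Euler contraction. -/

section Koszul

variable {ι : Type*}
variable {M M' M'' : Type*} [AddCommGroup M] [Module ℂ M] [AddCommGroup M'] [Module ℂ M']
  [AddCommGroup M''] [Module ℂ M'']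

/-- The space of alternating `n`-forms on `ℂ^ι` with values in `M`. -/
abbrev AltForms (ι : Type*) (M : Type*) [AddCommGroup M] [Module ℂ M] (n : ℕ) :=
  (ι → ℂ) [⋀^Fin n]→ₗ[ℂ] M

theorem altForms_sum_apply {κ : Type*} (s : Finset κ) {n : ℕ} (f : κ → AltForms ι M n)
    (v : Fin n → ι → ℂ) : (∑ i ∈ s, f i) v = ∑ i ∈ s, f i v := by
  classical
  induction s using Finset.induction_on with
  | empty => simp
  | insert a s ha ih => simp [Finset.sum_insert ha, ih]

variable [DecidableEq ι]

/-- The `i`-th vector of the standard basis of `ℂ^ι`. -/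
abbrev stdVec (i : ι) : ι → ℂ := Pi.single i 1

theorem vecCons_stdVec {n : ℕ} (i : ι) (J : Fin n → ι) :
    Matrix.vecCons (stdVec i) (fun k => stdVec (J k)) =
      fun k => stdVec ((Matrix.vecCons i J : Fin (n + 1) → ι) k) := by
  funext k
  refine Fin.cases ?_ (fun k => ?_) k <;> simp

variable [Fintype ι]

/-- The contraction `ω ↦ ∑ᵢ Tᵢ ∘ ω(eᵢ, ·)` of alternating forms against linear maps `Tᵢ`; for
commuting endomorphisms `Tᵢ` this is the differential of their Koszul complex. -/
def contract (T : ι → M →ₗ[ℂ] M') {n : ℕ} : AltForms ι M (n + 1) →ₗ[ℂ] AltForms ι M' n where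
  toFun ω := ∑ i, (T i).compAlternatingMap (ω.curryLeft (stdVec i))
  map_add' ω η := by
    ext v
    simp [altForms_sum_apply, Finset.sum_add_distrib]
  map_smul' c ω := by
    ext v
    simp [altForms_sum_apply, Finset.smul_sum]

theorem contract_apply (T : ι → M →ₗ[ℂ] M') {n : ℕ} (ω : AltForms ι M (n + 1))
    (v : Fin n → ι → ℂ) :
    contract T ω v = ∑ i, T i (ω (Matrix.vecCons (stdVec i) v)) := by
  simp [contract, altForms_sum_apply]

/-- Exchanging `i` and `j` preserves `Q` and changes the sign of `ω`, so the sum is its own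
negative. Both "the differential squares to zero" and the anticommutation in
`contract_koszulOp_shift` are instances. -/
theorem sum_symm_contract_eq_zero {n : ℕ} (Q : ι → ι → M →ₗ[ℂ] M') (hQ : ∀ i j, Q i j = Q j i)
    (ω : AltForms ι M (n + 2)) (v : Fin n → ι → ℂ) :
    ∑ i, ∑ j, Q i j (ω (Matrix.vecCons (stdVec j) (Matrix.vecCons (stdVec i) v))) = 0 := by
  have hswap : ∀ i j, ω (Matrix.vecCons (stdVec j) (Matrix.vecCons (stdVec i) v)) =
      -ω (Matrix.vecCons (stdVec i) (Matrix.vecCons (stdVec j) v)) := by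
    intro i j
    rw [← ω.map_swap _ (show (0 : Fin (n + 2)) ≠ 1 by simp)]
    congr 1
    funext k
    refine Fin.cases ?_ (fun k => Fin.cases ?_ (fun k => ?_) k) k
    · simp
    · simp [Fin.succ_zero_eq_one]
    · rw [Function.comp_apply, Equiv.swap_apply_of_ne_of_ne (by simp [Fin.ext_iff])
        (by simp [Fin.ext_iff])]
      simp
  have h : ∑ i, ∑ j, Q i j (ω (Matrix.vecCons (stdVec j) (Matrix.vecCons (stdVec i) v))) =
      -∑ i, ∑ j, Q i j (ω (Matrix.vecCons (stdVec j) (Matrix.vecCons (stdVec i) v))) := by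
    conv_lhs => rw [Finset.sum_comm]
    rw [← Finset.sum_neg_distrib]
    refine Finset.sum_congr rfl fun i _ => ?_
    rw [← Finset.sum_neg_distrib]
    refine Finset.sum_congr rfl fun j _ => ?_
    rw [hswap j i, map_neg, hQ]
  have h2 := eq_neg_iff_add_eq_zero.1 h
  rw [← two_smul ℂ] at h2
  exact (smul_eq_zero.1 h2).resolve_left two_ne_zero

theorem contract_contract_eq_zero {n : ℕ} (S : ι → M' →ₗ[ℂ] M'') (T : ι → M →ₗ[ℂ] M')
    (h : ∀ i j, S i ∘ₗ T j = S j ∘ₗ T i) (ω : AltForms ι M (n + 2)) :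
    contract S (contract T ω) = 0 := by
  ext v
  have := sum_symm_contract_eq_zero (fun i j => S i ∘ₗ T j) h ω v
  simpa [contract_apply] using this

theorem comp_contract (f : M' →ₗ[ℂ] M'') (T : ι → M →ₗ[ℂ] M') {n : ℕ}
    (ω : AltForms ι M (n + 1)) :
    f.compAlternatingMap (contract T ω) = contract (fun i => f ∘ₗ T i) ω := by
  ext v
  simp [contract_apply]

theorem contract_comp (T : ι → M' →ₗ[ℂ] M'') (f : M →ₗ[ℂ] M') {n : ℕ}
    (ω : AltForms ι M (n + 1)) :
    contract T (f.compAlternatingMap ω) = contract (fun i => T i ∘ₗ f) ω := by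
  ext v
  simp [contract_apply]

/-- The exterior derivative of an alternating form with respect to endomorphisms `Dᵢ` of the space
of values. -/
def extDeriv (D : ι → M →ₗ[ℂ] M) {n : ℕ} (ω : AltForms ι M n) : AltForms ι M (n + 1) :=
  AlternatingMap.alternatizeUncurryFin
    { toFun := fun v => ∑ i, v i • (D i).compAlternatingMap ω
      map_add' := fun v w => by simp [add_smul, Finset.sum_add_distrib]
      map_smul' := fun c v => by simp [Finset.smul_sum, smul_smul] }

theorem extDeriv_apply_stdVec (D : ι → M →ₗ[ℂ] M) {n : ℕ} (ω : AltForms ι M n)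
    (J : Fin (n + 1) → ι) :
    extDeriv D ω (fun k => stdVec (J k)) =
      ∑ k : Fin (n + 1), (-1 : ℂ) ^ (k : ℕ) • D (J k) (ω fun l => stdVec (J (k.succAbove l))) := by
  rw [extDeriv, AlternatingMap.alternatizeUncurryFin_apply]
  refine Finset.sum_congr rfl fun k _ => ?_
  have : ((-1 : ℤ) ^ (k : ℕ)) • D (J k) (ω fun l => stdVec (J (k.succAbove l))) =
      (-1 : ℂ) ^ (k : ℕ) • D (J k) (ω fun l => stdVec (J (k.succAbove l))) := by
    rcases Nat.even_or_odd (k : ℕ) with h | h <;> simp [h.neg_one_pow]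
  rw [← this]
  simp [Pi.single_apply, ite_smul]
  rfl

/-- The number of entries of `J` that lie in `S`. -/
def weight (S : Finset ι) {n : ℕ} (J : Fin n → ι) : ℕ := (Finset.univ.filter fun k => J k ∈ S).card

variable {S : Finset ι} {T D : ι → M →ₗ[ℂ] M}

theorem contract_extDeriv_zero (ω : AltForms ι M 0) (J : Fin 0 → ι) :
    contract T (extDeriv D ω) (fun k => stdVec (J k)) =
      ∑ i, T i (D i (ω fun k => stdVec (J k))) := by
  rw [contract_apply]
  refine Finset.sum_congr rfl fun i _ => ?_
  rw [vecCons_stdVec, extDeriv_apply_stdVec]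
  rw [Fin.sum_univ_succ, Fin.sum_univ_zero, add_zero, Fin.val_zero, pow_zero, one_smul]
  congr 3

/-- Cartan's formula. Differentiating along the newly inserted direction gives the Euler operator
$\sum_i T_iD_i$; the other terms combine into the commutators $[D_{J_k},T_i]$, and each index of `J`
in `S` contributes one copy of `ω`. -/
theorem contract_extDeriv_succ {n : ℕ}
    (hDT : ∀ i j m, D i (T j m) - T j (D i m) = if i = j ∧ i ∈ S then m else 0)
    (ω : AltForms ι M (n + 1)) (J : Fin (n + 1) → ι) :
    contract T (extDeriv D ω) (fun k => stdVec (J k)) +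
      extDeriv D (contract T ω) (fun k => stdVec (J k)) =
      ∑ i, T i (D i (ω fun k => stdVec (J k))) +
        (weight S J : ℂ) • ω fun k => stdVec (J k) := by
  have h1 : contract T (extDeriv D ω) (fun k => stdVec (J k)) =
      ∑ i, T i (D i (ω fun k => stdVec (J k))) - ∑ k : Fin (n + 1), (-1 : ℂ) ^ (k : ℕ) •
        ∑ i, T i (D (J k)
        (ω (Matrix.vecCons (stdVec i) fun l => stdVec (J (k.succAbove l))))) := by
    rw [contract_apply]
    simp only [Finset.smul_sum]
    rw [Finset.sum_comm, ← Finset.sum_sub_distrib]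
    refine Finset.sum_congr rfl fun i _ => ?_
    rw [vecCons_stdVec, extDeriv_apply_stdVec, Fin.sum_univ_succ]
    simp only [Fin.val_zero, pow_zero, one_smul, Matrix.cons_val_zero, Fin.zero_succAbove,
      Matrix.cons_val_succ, Fin.val_succ, map_add, map_sum, map_smul, sub_eq_add_neg]
    congr 1
    rw [← Finset.sum_neg_distrib]
    refine Finset.sum_congr rfl fun k _ => ?_
    rw [pow_succ, mul_neg_one, neg_smul, vecCons_stdVec]
    congr 5
    funext l
    refine Fin.cases ?_ (fun l => ?_) l <;> simp
  have h2 : extDeriv D (contract T ω) (fun k => stdVec (J k)) =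
      ∑ k : Fin (n + 1), (-1 : ℂ) ^ (k : ℕ) • ∑ i, D (J k) (T i
        (ω (Matrix.vecCons (stdVec i) fun l => stdVec (J (k.succAbove l))))) := by
    rw [extDeriv_apply_stdVec]
    simp [contract_apply]
  -- Moving entry `k` to the front costs $(-1)^k$, which cancels the sign in `extDeriv`.
  have h3 : ∀ k : Fin (n + 1), ω (Matrix.vecCons (stdVec (J k))
      fun l => stdVec (J (k.succAbove l))) = (-1 : ℂ) ^ (k : ℕ) • ω fun k => stdVec (J k) := by
    intro k
    rw [← AlternatingMap.neg_one_pow_smul_map_insertNth]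
    have : k.insertNth (stdVec (J k)) (fun l => stdVec (J (k.succAbove l))) =
        fun k => (stdVec (J k) : ι → ℂ) :=
      Fin.insertNth_self_removeNth k (fun k => (stdVec (J k) : ι → ℂ))
    rw [this]
    rcases Nat.even_or_odd (k : ℕ) with h | h <;> simp [h.neg_one_pow]
  rw [h1, h2, sub_add_eq_add_sub, add_sub_assoc, ← Finset.sum_sub_distrib]
  congr 1
  have h4 : ∀ k : Fin (n + 1), ((-1 : ℂ) ^ (k : ℕ) • ∑ i, D (J k) (T i
        (ω (Matrix.vecCons (stdVec i) fun l => stdVec (J (k.succAbove l)))))) -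
      ((-1 : ℂ) ^ (k : ℕ) • ∑ i, T i (D (J k)
        (ω (Matrix.vecCons (stdVec i) fun l => stdVec (J (k.succAbove l)))))) =
      if J k ∈ S then ω fun k => stdVec (J k) else 0 := by
    intro k
    rw [← smul_sub, ← Finset.sum_sub_distrib]
    simp only [hDT]
    by_cases hk : J k ∈ S
    · simp only [hk, and_true, if_true]
      rw [Finset.sum_ite_eq Finset.univ (J k), if_pos (Finset.mem_univ _), h3, smul_smul,
        ← mul_pow]
      simp
    · simp [hk]
  rw [Finset.sum_congr rfl fun k _ => h4 k, ← Finset.sum_filter, Finset.sum_const, weight,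
    Nat.cast_smul_eq_nsmul]

/-- A form is a Koszul cycle if it has degree zero or its contraction vanishes. -/
def IsKoszulCycle (T : ι → M →ₗ[ℂ] M) : {n : ℕ} → AltForms ι M n → Prop
  | 0, _ => True
  | _ + 1, ω => contract T ω = 0

theorem IsKoszulCycle.contract_extDeriv {n : ℕ} {ω : AltForms ι M n} (hω : IsKoszulCycle T ω)
    (hDT : ∀ i j m, D i (T j m) - T j (D i m) = if i = j ∧ i ∈ S then m else 0)
    (J : Fin n → ι) :
    contract T (extDeriv D ω) (fun k => stdVec (J k)) =
      ∑ i, T i (D i (ω fun k => stdVec (J k))) +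
        (weight S J : ℂ) • ω fun k => stdVec (J k) := by
  cases n with
  | zero => rw [contract_extDeriv_zero]; simp [weight]
  | succ n =>
    have hω' : contract T ω = 0 := hω
    rw [← contract_extDeriv_succ hDT, hω', extDeriv_apply_stdVec]
    simp

theorem isKoszulCycle_contract (hT : ∀ i j, T i ∘ₗ T j = T j ∘ₗ T i) {n : ℕ}
    (ω : AltForms ι M (n + 1)) : IsKoszulCycle T (contract T ω) := by
  cases n with
  | zero => trivial
  | succ n => exact contract_contract_eq_zero T T hT ω

theorem IsKoszulCycle.sub_smul {n : ℕ} {ω η : AltForms ι M n} (hω : IsKoszulCycle T ω)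
    (hη : IsKoszulCycle T η) (c : ℂ) : IsKoszulCycle T (ω - c • η) := by
  cases n with
  | zero => trivial
  | succ n =>
    have hω' : contract T ω = 0 := hω
    have hη' : contract T η = 0 := hη
    simp [IsKoszulCycle, hω', hη']

/-- If the operators `Tᵢ`, `i ∈ S`, admit "partial derivatives" `Dᵢ` and the Euler operator
`∑ᵢ Tᵢ Dᵢ` is triangular with eigenvalues `0, 1, 2, …` for a filtration `G`, then each Koszul cycle
is homologous to one that lives in filtration degree zero and is free of the indices in `S`. -/
theorem IsKoszulCycle.exists_reduced (hT : ∀ i j, T i ∘ₗ T j = T j ∘ₗ T i)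
    (hDT : ∀ i j m, D i (T j m) - T j (D i m) = if i = j ∧ i ∈ S then m else 0)
    (G : ℕ → Submodule ℂ M) (hG0 : G 0 = ⊥) (hmono : Monotone G) (hexh : ∀ m, ∃ d, m ∈ G d)
    (hG : ∀ d, ∀ m ∈ G (d + 1), ∑ i, T i (D i m) - (d : ℂ) • m ∈ G d)
    {n : ℕ} (ω : AltForms ι M n) (hω : IsKoszulCycle T ω) :
    ∃ (η : AltForms ι M (n + 1)) (ω₀ : AltForms ι M n), ω = contract T η + ω₀ ∧
      ∀ J : Fin n → ι, ω₀ (fun k => stdVec (J k)) ∈ G (1 - weight S J) := by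
  -- The total degree counts the filtration degree of a coefficient plus the number of indices in
  -- `S`; `e` bounds it and is lowered one by one.
  have key : ∀ e : ℕ, ∀ ω : AltForms ι M n, IsKoszulCycle T ω →
      (∀ J : Fin n → ι, ω (fun k => stdVec (J k)) ∈ G (e + 1 - weight S J)) →
      ∃ (η : AltForms ι M (n + 1)) (ω₀ : AltForms ι M n), ω = contract T η + ω₀ ∧
      ∀ J : Fin n → ι, ω₀ (fun k => stdVec (J k)) ∈ G (1 - weight S J) := by
    intro e
    induction e with
    | zero =>
      intro ω _ h
      exact ⟨0, ω, by simp, by simpa using h⟩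
    | succ e ih =>
      intro ω hω h
      have he : ((e : ℂ) + 1) ≠ 0 := Nat.cast_add_one_ne_zero e
      -- In total degree `e + 1` Cartan's operator acts on the leading part by `e + 1`: the Euler
      -- operator gives `e + 1 - weight S J`, the indices in `S` give the rest. Subtracting this
      -- exact form therefore removes the leading part.
      obtain ⟨η, ω₀, h1, h2⟩ := ih (ω - ((e : ℂ) + 1)⁻¹ • contract T (extDeriv D ω))
        (hω.sub_smul (isKoszulCycle_contract hT _) _) (by
          intro J
          rw [AlternatingMap.sub_apply, AlternatingMap.smul_apply, hω.contract_extDeriv hDT]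
          set m := ω fun k => stdVec (J k) with hm
          have hmem : m ∈ G (e + 1 + 1 - weight S J) := h J
          have e1 : m - ((e : ℂ) + 1)⁻¹ • (∑ i, T i (D i m) + (weight S J : ℂ) • m) =
              (-((e : ℂ) + 1)⁻¹) • (∑ i, T i (D i m) - ((e : ℂ) + 1 - weight S J) • m) := by
            match_scalars
            · field_simp
            · ring
          rw [e1]
          refine Submodule.smul_mem _ _ ?_
          by_cases hc : weight S J ≤ e + 1
          · have := hG (e + 1 - weight S J) m (by
              rwa [← Nat.sub_add_comm hc])
            rw [Nat.cast_sub hc] at this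
            simpa using this
          -- Here the truncated difference puts the coefficient in `G 0 = ⊥`.
          · have h0 : e + 1 + 1 - weight S J = 0 := by omega
            rw [h0, hG0, Submodule.mem_bot] at hmem
            simp [hmem])
      refine ⟨η + ((e : ℂ) + 1)⁻¹ • extDeriv D ω, ω₀, ?_, h2⟩
      rw [map_add, map_smul, add_right_comm, ← h1]
      simp
  choose d hd using fun J : Fin n → ι => hexh (ω fun k => stdVec (J k))
  -- The summand `n` compensates for subtracting `weight S J ≤ n`.
  let e := Finset.univ.sup d + n
  refine key e ω hω fun J => hmono ?_ (hd J)
  have h1 : d J ≤ Finset.univ.sup d := Finset.le_sup (Finset.mem_univ J)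
  have h2 : weight S J ≤ n := (Finset.card_le_univ _).trans (by simp)
  simp only [e]
  omega

end Koszul

/-! ### Bimodules and dimension shifting. -/

section Bimodules

variable {A : Type u} [CommRing A] [Algebra ℂ A]
variable {M : Type u} [AddCommGroup M] [Module ℂ M]

/-- An `A`-bimodule structure on the vector space `M`. -/
structure Bimod (A : Type u) [CommRing A] [Algebra ℂ A] (M : Type u) [AddCommGroup M]
    [Module ℂ M] where
  /-- the left action -/
  left : A →ₐ[ℂ] Module.End ℂ M
  /-- the right action -/
  right : A →ₐ[ℂ] Module.End ℂ M
  comm : ∀ a b m, left a (right b m) = right b (left a m)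

/-- The projection `A → A / ℂ1`. -/
abbrev toReduced (A : Type u) [CommRing A] [Algebra ℂ A] : A →ₗ[ℂ] Reduced A :=
  Submodule.mkQ (ℂ ∙ (1 : A))

theorem toReduced_one : toReduced A 1 = 0 :=
  (Submodule.Quotient.mk_eq_zero _).2 (Submodule.mem_span_singleton_self 1)

theorem toReduced_algebraMap (c : ℂ) : toReduced A (algebraMap ℂ A c) = 0 := by
  rw [Algebra.algebraMap_eq_smul_one, map_smul, toReduced_one, smul_zero]

theorem tensor_reduced_ext {N : Type*} [AddCommGroup N] [Module ℂ N]
    {f f' : M ⊗[ℂ] Reduced A →ₗ[ℂ] N}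
    (h : ∀ m a, f (m ⊗ₜ toReduced A a) = f' (m ⊗ₜ toReduced A a)) : f = f' := by
  refine TensorProduct.ext' fun m a => ?_
  obtain ⟨a, rfl⟩ := Submodule.mkQ_surjective _ a
  exact h m a

/-- A linear map out of `M ⊗ A/ℂ1` from a bilinear map that vanishes at `1`. -/
def liftReduced {N : Type*} [AddCommGroup N] [Module ℂ N] (f : A →ₗ[ℂ] M →ₗ[ℂ] N)
    (hf : f 1 = 0) : M ⊗[ℂ] Reduced A →ₗ[ℂ] N :=
  TensorProduct.lift (Submodule.liftQ _ f (by
    rwa [Submodule.span_singleton_le_iff_mem, LinearMap.mem_ker])).flip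

theorem liftReduced_tmul {N : Type*} [AddCommGroup N] [Module ℂ N] (f : A →ₗ[ℂ] M →ₗ[ℂ] N)
    (hf : f 1 = 0) (m : M) (a : A) :
    liftReduced f hf (m ⊗ₜ toReduced A a) = f a m := by
  simp [liftReduced]

/-- The map `m ↦ m ⊗ ā`. -/
def tensorRight (M : Type u) [AddCommGroup M] [Module ℂ M] (a : A) :
    M →ₗ[ℂ] M ⊗[ℂ] Reduced A :=
  (TensorProduct.mk ℂ M (Reduced A)).flip (toReduced A a)

@[simp]
theorem tensorRight_apply (a : A) (m : M) : tensorRight M a m = m ⊗ₜ toReduced A a := rfl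

namespace Bimod

variable (X : Bimod A M)

theorem left_mul (a b : A) (m : M) : X.left (a * b) m = X.left a (X.left b m) := by
  rw [map_mul]; rfl

theorem right_mul (a b : A) (m : M) : X.right (a * b) m = X.right a (X.right b m) := by
  rw [map_mul]; rfl

/-- The left action `c · (m ⊗ ā) = m ⊗ (ca) - am ⊗ c` on `M ⊗ A/ℂ1`. -/
def shiftLeft (c : A) : M ⊗[ℂ] Reduced A →ₗ[ℂ] M ⊗[ℂ] Reduced A :=
  liftReduced
    ((TensorProduct.mk ℂ M (Reduced A)).flip ∘ₗ toReduced A ∘ₗ LinearMap.mulLeft ℂ c -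
      LinearMap.llcomp ℂ M M _ (tensorRight M c) ∘ₗ X.left.toLinearMap)
    (by ext m; simp)

theorem shiftLeft_tmul (c : A) (m : M) (a : A) :
    X.shiftLeft c (m ⊗ₜ toReduced A a) =
      m ⊗ₜ toReduced A (c * a) - X.left a m ⊗ₜ toReduced A c := by
  rw [shiftLeft, liftReduced_tmul]
  rfl

/-- The bimodule `M ⊗ A/ℂ1`, isomorphic to the kernel of the multiplication `A ⊗ M → M`. -/
def shift : Bimod A (M ⊗[ℂ] Reduced A) where
  left := AlgHom.ofLinearMap
    { toFun := X.shiftLeft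
      map_add' := fun c d => tensor_reduced_ext fun m a => by
        simp only [shiftLeft_tmul, LinearMap.add_apply, add_mul, map_add, TensorProduct.tmul_add]
        abel
      map_smul' := fun r c => tensor_reduced_ext fun m a => by
        simp only [shiftLeft_tmul, LinearMap.smul_apply, smul_mul_assoc, map_smul,
          TensorProduct.tmul_smul, RingHom.id_apply, smul_sub] }
    (tensor_reduced_ext fun m a => by
      change X.shiftLeft 1 _ = _
      rw [shiftLeft_tmul, toReduced_one]
      simp)
    (fun c d => tensor_reduced_ext fun m a => by
      simp only [LinearMap.coe_mk, AddHom.coe_mk, Module.End.mul_apply, shiftLeft_tmul, map_sub,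
        left_mul, mul_assoc]
      abel)
  right := AlgHom.ofLinearMap
    { toFun := fun c => (X.right c).rTensor (Reduced A)
      map_add' := fun c d => by rw [map_add, LinearMap.rTensor_add]
      map_smul' := fun r c => by rw [map_smul, LinearMap.rTensor_smul]; rfl }
    (by
      change (X.right 1).rTensor (Reduced A) = _
      rw [map_one]
      exact LinearMap.rTensor_id _ _)
    (fun c d => by
      change (X.right (c * d)).rTensor (Reduced A) = _
      rw [map_mul]
      exact LinearMap.rTensor_comp _ _ _)
  comm c d t := by
    refine LinearMap.congr_fun (f := X.shiftLeft c ∘ₗ (X.right d).rTensor (Reduced A))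
      (g := (X.right d).rTensor (Reduced A) ∘ₗ X.shiftLeft c)
      (tensor_reduced_ext fun m a => ?_) t
    simp only [LinearMap.comp_apply, LinearMap.rTensor_tmul, shiftLeft_tmul, map_sub, X.comm]

theorem shift_left_tmul (c : A) (m : M) (a : A) :
    X.shift.left c (m ⊗ₜ toReduced A a) =
      m ⊗ₜ toReduced A (c * a) - X.left a m ⊗ₜ toReduced A c :=
  X.shiftLeft_tmul c m a

theorem shift_right_tmul (c : A) (m : M) (a : Reduced A) :
    X.shift.right c (m ⊗ₜ a) = X.right c m ⊗ₜ a := rfl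

/-- The commutator `m ⊗ ā ↦ m a - a m`. -/
def commutator : M ⊗[ℂ] Reduced A →ₗ[ℂ] M :=
  liftReduced (X.right.toLinearMap - X.left.toLinearMap) (by simp)

theorem commutator_tmul (m : M) (a : A) :
    X.commutator (m ⊗ₜ toReduced A a) = X.right a m - X.left a m := by
  rw [commutator, liftReduced_tmul]
  rfl

/-- The only case of $b^2=0$ computed by hand; dimension shifting reduces the others to it.
Commutativity of `A` enters because `right` is a homomorphism, not an antihomomorphism. -/
theorem commutator_shift_commutator : X.commutator ∘ₗ X.shift.commutator = 0 := by
  refine tensor_reduced_ext fun t a => ?_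
  refine LinearMap.congr_fun (f := X.commutator ∘ₗ X.shift.commutator ∘ₗ
    tensorRight (M ⊗[ℂ] Reduced A) a) (g := 0) (tensor_reduced_ext fun m b => ?_) t
  simp only [LinearMap.comp_apply, tensorRight_apply, commutator_tmul, shift_left_tmul,
    shift_right_tmul, map_sub, X.comm, LinearMap.zero_apply, left_mul, right_mul]
  rw [← X.right_mul b a, ← X.right_mul a b, mul_comm b a]
  abel

end Bimod

end Bimodules

/-! ### The Hochschild complex with coefficients, built by absorbing the last tensor factor. -/

section Chains

variable {A : Type u} [CommRing A] [Algebra ℂ A]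
variable {M : Type u} [AddCommGroup M] [Module ℂ M]

/-- Normalized Hochschild chains with coefficients in `M`. -/
abbrev CoeffChains (A : Type u) [CommRing A] [Algebra ℂ A] (M : Type u) [AddCommGroup M]
    [Module ℂ M] (n : ℕ) : Type u :=
  M ⊗[ℂ] (⨂[ℂ] _ : Fin n, Reduced A)

/-- The chain `m ⊗ a₁ ⊗ ⋯ ⊗ aₙ`. -/
def coeffChain {n : ℕ} (m : M) (a : Fin n → A) : CoeffChains A M n :=
  m ⊗ₜ[ℂ] PiTensorProduct.tprod ℂ fun k => toReduced A (a k)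

theorem coeffChains_ext {n : ℕ} {N : Type*} [AddCommMonoid N] [Module ℂ N]
    {f f' : CoeffChains A M n →ₗ[ℂ] N} (h : ∀ m a, f (coeffChain m a) = f' (coeffChain m a)) :
    f = f' := by
  refine TensorProduct.ext (LinearMap.ext fun m => PiTensorProduct.ext
    (MultilinearMap.ext fun v => ?_))
  have := h m (fun k => (v k).out)
  simpa [coeffChain] using this

/-- The isomorphism `m ⊗ a₁ ⊗ ⋯ ⊗ aₙ₊₁ ↦ (m ⊗ aₙ₊₁) ⊗ a₁ ⊗ ⋯ ⊗ aₙ`. -/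
def splitLast (A : Type u) [CommRing A] [Algebra ℂ A] (M : Type u) [AddCommGroup M]
    [Module ℂ M] (n : ℕ) :
    CoeffChains A M (n + 1) ≃ₗ[ℂ] CoeffChains A (M ⊗[ℂ] Reduced A) n :=
  TensorProduct.congr (LinearEquiv.refl ℂ M)
    (PiTensorProduct.reindex ℂ (fun _ => Reduced A) (finSumFinEquiv (m := n) (n := 1)).symm ≪≫ₗ
      (PiTensorProduct.tmulEquiv ℂ (Reduced A)).symm ≪≫ₗ
      TensorProduct.congr (LinearEquiv.refl ℂ _) (PiTensorProduct.subsingletonEquiv 0) ≪≫ₗ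
      TensorProduct.comm ℂ _ _) ≪≫ₗ
    (TensorProduct.assoc ℂ _ _ _).symm

theorem splitLast_tmul_tprod (n : ℕ) (m : M) (v : Fin (n + 1) → Reduced A) :
    splitLast A M n (m ⊗ₜ PiTensorProduct.tprod ℂ v) =
      (m ⊗ₜ v (Fin.last n)) ⊗ₜ PiTensorProduct.tprod ℂ fun k => v k.castSucc := by
  simp only [splitLast, LinearEquiv.trans_apply, TensorProduct.congr_tmul, LinearEquiv.refl_apply]
  erw [PiTensorProduct.reindex_tprod]
  rw [PiTensorProduct.tmulEquiv_symm_apply]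
  simp
  rfl

theorem splitLast_coeffChain (n : ℕ) (m : M) (a : Fin (n + 1) → A) :
    splitLast A M n (coeffChain m a) =
      coeffChain (m ⊗ₜ toReduced A (a (Fin.last n))) fun k => a k.castSucc :=
  splitLast_tmul_tprod n m _

theorem splitLast_symm_coeffChain (n : ℕ) (m : M) (b : A) (a : Fin n → A) :
    (splitLast A M n).symm (coeffChain (m ⊗ₜ toReduced A b) a) =
      coeffChain m (Fin.snoc (α := fun _ => A) a b) := by
  rw [LinearEquiv.symm_apply_eq, splitLast_coeffChain]
  simp

/-- The Hochschild boundary with coefficients in a bimodule. -/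
def bdry : (n : ℕ) → {M : Type u} → [AddCommGroup M] → [Module ℂ M] → Bimod A M →
    (CoeffChains A M (n + 1) →ₗ[ℂ] CoeffChains A M n)
  | 0, M, _, _, X => X.commutator.rTensor _ ∘ₗ (splitLast A M 0).toLinearMap
  | n + 1, M, _, _, X =>
    (splitLast A M n).symm.toLinearMap ∘ₗ bdry n X.shift ∘ₗ (splitLast A M (n + 1)).toLinearMap

theorem bdry_zero_apply (X : Bimod A M) (z : CoeffChains A M 1) :
    bdry 0 X z = X.commutator.rTensor _ (splitLast A M 0 z) := rfl

theorem bdry_succ_apply (X : Bimod A M) (n : ℕ) (z : CoeffChains A M (n + 2)) :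
    bdry (n + 1) X z = (splitLast A M n).symm (bdry n X.shift (splitLast A M (n + 1) z)) := rfl

theorem bdry_bdry (n : ℕ) : ∀ {M : Type u} [AddCommGroup M] [Module ℂ M] (X : Bimod A M)
    (z : CoeffChains A M (n + 2)), bdry n X (bdry (n + 1) X z) = 0 := by
  induction n with
  | zero =>
    intro M _ _ X z
    rw [bdry_succ_apply, bdry_zero_apply, LinearEquiv.apply_symm_apply, bdry_zero_apply,
      ← LinearMap.comp_apply, ← LinearMap.rTensor_comp, X.commutator_shift_commutator,
      LinearMap.rTensor_zero, LinearMap.zero_apply]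
  | succ n ih =>
    intro M _ _ X z
    rw [bdry_succ_apply, bdry_succ_apply, LinearEquiv.apply_symm_apply, ih, map_zero]

end Chains

/-! ### Antisymmetrization from the Koszul to the Hochschild complex. -/

section Antisymmetrization

variable {A : Type u} [CommRing A] [Algebra ℂ A]
variable {M : Type u} [AddCommGroup M] [Module ℂ M]
variable {ι : Type*} [Fintype ι] [DecidableEq ι]

/-- The Koszul operators `m ↦ m xᵢ - xᵢ m` of a bimodule. -/
def Bimod.koszulOp (X : Bimod A M) (x : ι → A) (i : ι) : M →ₗ[ℂ] M :=
  X.right (x i) - X.left (x i)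

/-- The antisymmetrization map from the Koszul complex to the Hochschild complex. -/
def antisymm (x : ι → A) : (n : ℕ) → {M : Type u} → [AddCommGroup M] → [Module ℂ M] →
    (AltForms ι M n →ₗ[ℂ] CoeffChains A M n)
  | 0, M, _, _ =>
    { toFun := fun ω => coeffChain (ω ![]) ![]
      map_add' := fun ω η => by simp [coeffChain, TensorProduct.add_tmul]
      map_smul' := fun c ω => by simp [coeffChain, TensorProduct.smul_tmul'] }
  | n + 1, M, _, _ => (splitLast A M n).symm.toLinearMap ∘ₗ antisymm x n ∘ₗ
      contract fun i => tensorRight M (x i)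

theorem antisymm_zero_apply (x : ι → A) (ω : AltForms ι M 0) :
    antisymm x 0 ω = coeffChain (ω ![]) ![] := rfl

theorem antisymm_succ_apply (x : ι → A) (n : ℕ) (ω : AltForms ι M (n + 1)) :
    antisymm x (n + 1) ω = (splitLast A M n).symm
      (antisymm x n (contract (fun i => tensorRight M (x i)) ω)) := rfl

/-- The sum of the two composites is $m x_i\otimes x_j+m x_j\otimes x_i-m\otimes x_ix_j$, symmetric
in $i,j$, so it cancels against an alternating form. -/
theorem contract_koszulOp_shift (X : Bimod A M) (x : ι → A) {n : ℕ}
    (ω : AltForms ι M (n + 2)) :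
    contract (X.shift.koszulOp x) (contract (fun i => tensorRight M (x i)) ω) =
      -contract (fun i => tensorRight M (x i)) (contract (X.koszulOp x) ω) := by
  rw [eq_neg_iff_add_eq_zero]
  ext v
  have := sum_symm_contract_eq_zero (fun i j => X.shift.koszulOp x i ∘ₗ tensorRight M (x j) +
    tensorRight M (x i) ∘ₗ X.koszulOp x j) (fun i j => by
      ext m
      simp only [LinearMap.add_apply, LinearMap.comp_apply, tensorRight_apply, Bimod.koszulOp,
        LinearMap.sub_apply, X.shift_left_tmul, X.shift_right_tmul, TensorProduct.sub_tmul,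
        mul_comm (x i)]
      abel) ω v
  simp only [AlternatingMap.add_apply, contract_apply, map_sum, ← Finset.sum_add_distrib,
    AlternatingMap.zero_apply]
  simpa using this

/-- Antisymmetrization is a chain map up to sign; each dimension shift contributes one factor $-1$.
-/
theorem bdry_antisymm (x : ι → A) (n : ℕ) : ∀ {M : Type u} [AddCommGroup M] [Module ℂ M]
    (X : Bimod A M) (ω : AltForms ι M (n + 1)),
    bdry n X (antisymm x (n + 1) ω) = (-1 : ℂ) ^ n • antisymm x n (contract (X.koszulOp x) ω) := by
  induction n with
  | zero =>
    intro M _ _ X ω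
    rw [bdry_zero_apply, antisymm_succ_apply, LinearEquiv.apply_symm_apply, antisymm_zero_apply,
      antisymm_zero_apply, coeffChain, LinearMap.rTensor_tmul, pow_zero, one_smul, coeffChain,
      contract_apply, contract_apply, map_sum]
    simp only [tensorRight_apply, X.commutator_tmul]
    rfl
  | succ n ih =>
    intro M _ _ X ω
    rw [bdry_succ_apply, antisymm_succ_apply, LinearEquiv.apply_symm_apply, ih,
      contract_koszulOp_shift, antisymm_succ_apply]
    simp [pow_succ]

/-- The order is reversed because contraction uses the first slot of the form while `splitLast`
stores the factor in the last slot of the chain. -/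
theorem antisymm_eq_sum (x : ι → A) (n : ℕ) : ∀ {M : Type u} [AddCommGroup M] [Module ℂ M]
    (ω : AltForms ι M n), antisymm x n ω =
      ∑ J : Fin n → ι, coeffChain (ω fun k => stdVec (J k)) (fun k => x (J k.rev)) := by
  induction n with
  | zero =>
    intro M _ _ ω
    rw [antisymm_zero_apply, Fintype.sum_unique]
    congr 1
    · congr 1; exact Subsingleton.elim _ _
    · exact Subsingleton.elim _ _
  | succ n ih =>
    intro M _ _ ω
    rw [antisymm_succ_apply, ih, map_sum, ← (Fin.consEquiv fun _ : Fin (n + 1) => ι).sum_comp,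
      Fintype.sum_prod_type, Finset.sum_comm]
    refine Finset.sum_congr rfl fun J _ => ?_
    rw [contract_apply, coeffChain, TensorProduct.sum_tmul, map_sum]
    refine Finset.sum_congr rfl fun i _ => ?_
    rw [tensorRight_apply]
    refine (splitLast_symm_coeffChain n _ _ _).trans ?_
    congr 1
    · rw [vecCons_stdVec]; rfl
    · funext k
      refine Fin.lastCases ?_ (fun k => ?_) k
      · simp [Fin.consEquiv]
      · simp [Fin.consEquiv, Fin.rev_castSucc]

end Antisymmetrization

/-! ### The recursive boundary agrees with the alternating sum of faces. -/

section Comparison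

variable {A : Type u} [CommRing A] [Algebra ℂ A]
variable {M : Type u} [AddCommGroup M] [Module ℂ M]

/-- The coefficient of the `i`-th face of `m ⊗ a₁ ⊗ ⋯ ⊗ aₙ₊₁`. -/
def faceCoeff (X : Bimod A M) {n : ℕ} (i : Fin (n + 2)) (m : M) (a : Fin (n + 1) → A) : M :=
  if i = 0 then X.right (a 0) m
  else if i = Fin.last (n + 1) then X.left (a (Fin.last n)) m
  else m

/-- The remaining entries of the `i`-th face of `m ⊗ a₁ ⊗ ⋯ ⊗ aₙ₊₁`. -/
def faceArgs {n : ℕ} (i : Fin (n + 2)) (a : Fin (n + 1) → A) (k : Fin n) : A :=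
  if (k : ℕ) + 1 < i then a k.castSucc
  else if (k : ℕ) + 1 = i then a k.castSucc * a k.succ
  else a k.succ

/-- All faces but the last two leave $a_{n+1}$ untouched and come from the shifted bimodule
unchanged. The two terms of the shifted left action produce the last two faces, with opposite signs.
-/
theorem bdry_coeffChain (n : ℕ) : ∀ {M : Type u} [AddCommGroup M] [Module ℂ M] (X : Bimod A M)
    (m : M) (a : Fin (n + 1) → A), bdry n X (coeffChain m a) =
      ∑ i : Fin (n + 2), (-1 : ℂ) ^ (i : ℕ) • coeffChain (faceCoeff X i m a) (faceArgs i a) := by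
  induction n with
  | zero =>
    intro M _ _ X m a
    rw [bdry_zero_apply, splitLast_coeffChain, coeffChain, LinearMap.rTensor_tmul,
      X.commutator_tmul, Fin.sum_univ_two, TensorProduct.sub_tmul, sub_eq_add_neg]
    have h : ∀ b c : Fin 0 → Reduced A, PiTensorProduct.tprod ℂ b = PiTensorProduct.tprod ℂ c :=
      fun b c => congrArg _ (Subsingleton.elim _ _)
    simp only [faceCoeff, coeffChain, Fin.val_zero, pow_zero, one_smul, Fin.val_one, pow_one,
      neg_smul, if_true]
    rw [if_neg (by simp), if_pos (by rfl)]
    rw [h (fun k => toReduced A (a k.castSucc)) (fun k => toReduced A (faceArgs 0 a k)),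
      h (fun k => toReduced A (faceArgs 1 a k)) (fun k => toReduced A (faceArgs 0 a k))]
    rfl
  | succ n ih =>
    intro M _ _ X m a
    rw [bdry_succ_apply, splitLast_coeffChain, ih, map_sum, Fin.sum_univ_castSucc,
      Fin.sum_univ_castSucc (n := n + 2), Fin.sum_univ_castSucc (n := n + 1), add_assoc]
    congr 1
    · refine Finset.sum_congr rfl fun i _ => ?_
      rw [map_smul]
      have hc : faceCoeff X.shift i.castSucc (m ⊗ₜ toReduced A (a (Fin.last (n + 1))))
          (fun k => a k.castSucc) =
          faceCoeff X i.castSucc.castSucc m a ⊗ₜ toReduced A (a (Fin.last (n + 1))) := by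
        have h1 : (i.castSucc : Fin (n + 2)) ≠ Fin.last (n + 1) := i.castSucc_ne_last
        have h2 : (i.castSucc.castSucc : Fin (n + 3)) ≠ Fin.last (n + 2) :=
          i.castSucc.castSucc_ne_last
        simp only [faceCoeff, h1, h2, if_false, Fin.castSucc_eq_zero_iff]
        split_ifs <;> simp [X.shift_right_tmul]
      rw [hc, splitLast_symm_coeffChain]
      simp only [Fin.val_castSucc]
      congr 2
      funext k
      refine Fin.lastCases ?_ (fun k => ?_) k
      · have : (i : ℕ) < n + 1 := i.2
        rw [Fin.snoc_last, faceArgs]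
        simp only [Fin.val_last, Fin.val_castSucc]
        rw [if_neg (by omega), if_neg (by omega), Fin.succ_last]
      · rw [Fin.snoc_castSucc, faceArgs, faceArgs]
        simp only [Fin.val_castSucc, Fin.succ_castSucc]
    · have hc : faceCoeff X.shift (Fin.last (n + 1)) (m ⊗ₜ toReduced A (a (Fin.last (n + 1))))
          (fun k => a k.castSucc) =
          m ⊗ₜ toReduced A (a (Fin.last n).castSucc * a (Fin.last (n + 1))) -
            X.left (a (Fin.last (n + 1))) m ⊗ₜ toReduced A (a (Fin.last n).castSucc) := by
        rw [faceCoeff, if_neg (by simp), if_pos rfl, X.shift_left_tmul]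
      rw [hc, coeffChain, TensorProduct.sub_tmul, map_smul, map_sub]
      have hs := splitLast_symm_coeffChain (A := A) (M := M) n
      simp only [coeffChain] at hs
      rw [hs, hs, smul_sub, sub_eq_add_neg, ← neg_smul]
      simp only [Fin.val_castSucc, Fin.val_last]
      congr 1
      · congr 1
        rw [faceCoeff, if_neg (by simp), if_neg (by simp [Fin.ext_iff]), coeffChain]
        congr 2
        funext k
        congr 1
        refine Fin.lastCases ?_ (fun k => ?_) k
        · simp [faceArgs]
        · have : (k : ℕ) < n := k.2
          simp [faceArgs]
      · congr 1
        · rw [pow_succ]; ring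
        rw [faceCoeff, if_neg (by simp), if_pos rfl, coeffChain]
        congr 2
        funext k
        congr 1
        refine Fin.lastCases ?_ (fun k => ?_) k
        · simp [faceArgs]
        · have : (k : ℕ) < n := k.2
          simp [faceArgs, show (k : ℕ) < n + 1 by omega]

/-- The bimodule `A` with the right action twisted by `g`. -/
def Bimod.twisted (g : A →ₐ[ℂ] A) : Bimod A A where
  left := Algebra.lmul ℂ A
  right := (Algebra.lmul ℂ A).comp g
  comm a b m := mul_left_comm a (g b) m

theorem Bimod.twisted_left (g : A →ₐ[ℂ] A) (a m : A) : (Bimod.twisted g).left a m = a * m := rfl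

theorem Bimod.twisted_right (g : A →ₐ[ℂ] A) (a m : A) :
    (Bimod.twisted g).right a m = g a * m := rfl

theorem boundary_eq_bdry (g : A →ₐ[ℂ] A) (n : ℕ) : boundary g n = bdry n (Bimod.twisted g) := by
  refine chains_ext fun x => ?_
  rw [boundary_chain]
  refine Eq.trans ?_ (bdry_coeffChain n (Bimod.twisted g) x.1 x.2).symm
  refine Finset.sum_congr rfl fun i _ => ?_
  congr 1
  have h : (face g i x).1 = faceCoeff (Bimod.twisted g) i x.1 x.2 := by
    simp only [face, faceCoeff, Bimod.twisted_left, Bimod.twisted_right, mul_comm x.1]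
  rw [chain, h]
  rfl

end Comparison

/-! ### Every Hochschild cycle of positive degree comes from a Koszul cycle. -/

section Surjectivity

variable {A : Type u} [CommRing A] [Algebra ℂ A]
variable {M : Type u} [AddCommGroup M] [Module ℂ M]
variable {ι : Type*}

/-- The multiplication `A ⊗ M → M`. -/
def Bimod.act (X : Bimod A M) : A ⊗[ℂ] M →ₗ[ℂ] M := TensorProduct.lift X.left.toLinearMap

theorem Bimod.act_tmul (X : Bimod A M) (a : A) (m : M) : X.act (a ⊗ₜ m) = X.left a m := rfl

/-- The inclusion `M ⊗ A/ℂ1 → A ⊗ M`, `m ⊗ ā ↦ a ⊗ m - 1 ⊗ am`. -/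
def Bimod.incl (X : Bimod A M) : M ⊗[ℂ] Reduced A →ₗ[ℂ] A ⊗[ℂ] M :=
  liftReduced
    { toFun := fun a => TensorProduct.mk ℂ A M a - TensorProduct.mk ℂ A M 1 ∘ₗ X.left a
      map_add' := fun a b => by
        ext m
        simp only [map_add, LinearMap.sub_apply, LinearMap.add_apply, LinearMap.comp_apply]
        abel
      map_smul' := fun r a => by
        ext m
        simp [smul_sub] }
    (by ext m; simp)

theorem Bimod.incl_tmul (X : Bimod A M) (m : M) (a : A) :
    X.incl (m ⊗ₜ toReduced A a) = a ⊗ₜ m - 1 ⊗ₜ X.left a m := by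
  rw [Bimod.incl, liftReduced_tmul]
  rfl

/-- The projection `A ⊗ M → M ⊗ A/ℂ1`, `a ⊗ m ↦ m ⊗ ā`. -/
def reduceLeft (A : Type u) [CommRing A] [Algebra ℂ A] (M : Type u) [AddCommGroup M]
    [Module ℂ M] : A ⊗[ℂ] M →ₗ[ℂ] M ⊗[ℂ] Reduced A :=
  (toReduced A).lTensor M ∘ₗ (TensorProduct.comm ℂ A M).toLinearMap

theorem reduceLeft_tmul (a : A) (m : M) : reduceLeft A M (a ⊗ₜ m) = m ⊗ₜ toReduced A a := rfl

theorem reduceLeft_comp_incl (X : Bimod A M) : reduceLeft A M ∘ₗ X.incl = LinearMap.id := by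
  refine tensor_reduced_ext fun m a => ?_
  rw [LinearMap.comp_apply, X.incl_tmul, map_sub, reduceLeft_tmul, reduceLeft_tmul, toReduced_one]
  simp

/-- The Koszul operators `1 ⊗ rᵢ - xᵢ ⊗ 1` of the half-free bimodule `A ⊗ M`. -/
def freeOp (X : Bimod A M) (x : ι → A) (i : ι) : A ⊗[ℂ] M →ₗ[ℂ] A ⊗[ℂ] M :=
  (X.right (x i)).lTensor A - (LinearMap.mulLeft ℂ (x i)).rTensor M

theorem freeOp_tmul (X : Bimod A M) (x : ι → A) (i : ι) (a : A) (m : M) :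
    freeOp X x i (a ⊗ₜ m) = a ⊗ₜ X.right (x i) m - (x i * a) ⊗ₜ m := rfl

/-- Together with `act_comp_freeOp` this turns `incl` and `act` into maps of Koszul complexes, so
that connecting maps can be formed. -/
theorem freeOp_comp_incl (X : Bimod A M) (x : ι → A) (i : ι) :
    freeOp X x i ∘ₗ X.incl = X.incl ∘ₗ X.shift.koszulOp x i := by
  refine tensor_reduced_ext fun m a => ?_
  simp only [LinearMap.comp_apply, X.incl_tmul, map_sub, freeOp_tmul, Bimod.koszulOp,
    LinearMap.sub_apply, X.shift_left_tmul, X.shift_right_tmul, X.comm, X.left_mul, mul_one]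
  abel

theorem act_comp_freeOp (X : Bimod A M) (x : ι → A) (i : ι) :
    X.act ∘ₗ freeOp X x i = X.koszulOp x i ∘ₗ X.act := by
  refine TensorProduct.ext' fun a m => ?_
  simp only [LinearMap.comp_apply, freeOp_tmul, map_sub, X.act_tmul, Bimod.koszulOp,
    LinearMap.sub_apply, X.comm, X.left_mul]

theorem act_comp_incl (X : Bimod A M) : X.act ∘ₗ X.incl = 0 := by
  refine tensor_reduced_ext fun m a => ?_
  rw [LinearMap.comp_apply, X.incl_tmul, map_sub, X.act_tmul, X.act_tmul]
  simp

/-- `reduceLeft` is only a linear retraction of `incl`. Its failure to commute with the Koszul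
operators is exactly the term that defines antisymmetrization. -/
theorem koszulOp_comp_reduceLeft (X : Bimod A M) (x : ι → A) (i : ι) :
    X.shift.koszulOp x i ∘ₗ reduceLeft A M =
      reduceLeft A M ∘ₗ freeOp X x i + tensorRight M (x i) ∘ₗ X.act := by
  refine TensorProduct.ext' fun a m => ?_
  simp only [LinearMap.comp_apply, LinearMap.add_apply, reduceLeft_tmul, freeOp_tmul, map_sub,
    Bimod.koszulOp, LinearMap.sub_apply, X.shift_left_tmul, X.shift_right_tmul, X.act_tmul,
    tensorRight_apply]
  abel

/-- Generators `x` of `A` are coordinates if derivations may be prescribed on them freely. -/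
structure IsCoordinates (x : ι → A) : Prop where
  adjoin_eq_top : Algebra.adjoin ℂ (Set.range x) = ⊤
  exists_derivation : ∀ c : ι → A, ∃ D : Derivation ℂ A A, ∀ i, D (x i) = c i

theorem IsCoordinates.exists_partials [DecidableEq ι] {x : ι → A} (hx : IsCoordinates x) :
    ∃ D : ι → Derivation ℂ A A, ∀ i j, D i (x j) = if i = j then 1 else 0 := by
  choose D hD using fun i : ι => hx.exists_derivation fun j => if i = j then 1 else 0
  exact ⟨D, hD⟩

theorem derivation_sum_apply {κ : Type*} (s : Finset κ) (D : κ → Derivation ℂ A A) (a : A) :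
    (∑ i ∈ s, D i) a = ∑ i ∈ s, D i a := by
  classical
  induction s using Finset.induction_on with
  | empty => simp
  | insert i s hi ih => simp [Finset.sum_insert hi, ih]

section Filtration

variable [DecidableEq ι]

/-- The span of the monomials in the `xᵢ` with less than `e` factors with index in `S`. -/
def degreeLT (x : ι → A) (S : Finset ι) (e : ℕ) : Submodule ℂ A :=
  Submodule.span ℂ ((fun L : List ι => (L.map x).prod) '' {L | L.countP (· ∈ S) < e})

theorem prod_mem_degreeLT (x : ι → A) (S : Finset ι) {e : ℕ} {L : List ι}
    (h : L.countP (· ∈ S) < e) : (L.map x).prod ∈ degreeLT x S e :=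
  Submodule.subset_span ⟨L, h, rfl⟩

theorem degreeLT_zero (x : ι → A) (S : Finset ι) : degreeLT x S 0 = ⊥ := by
  simp [degreeLT]

theorem degreeLT_mono (x : ι → A) (S : Finset ι) : Monotone (degreeLT x S) :=
  fun _ _ h => Submodule.span_mono (Set.image_mono fun _ hL => lt_of_lt_of_le hL h)

theorem exists_mem_degreeLT {x : ι → A} (hx : Algebra.adjoin ℂ (Set.range x) = ⊤)
    (S : Finset ι) (a : A) : ∃ e, a ∈ degreeLT x S e := by
  have ha : a ∈ Submodule.span ℂ (Submonoid.closure (Set.range x) : Set A) := by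
    rw [← Algebra.adjoin_eq_span, hx]
    trivial
  induction ha using Submodule.span_induction with
  | mem a ha =>
    have : ∃ L : List ι, (L.map x).prod = a := by
      induction ha using Submonoid.closure_induction with
      | mem a ha =>
        obtain ⟨i, rfl⟩ := ha
        exact ⟨[i], by simp⟩
      | one => exact ⟨[], by simp⟩
      | mul a b _ _ ha hb =>
        obtain ⟨L, rfl⟩ := ha
        obtain ⟨L', rfl⟩ := hb
        exact ⟨L ++ L', by simp⟩
    obtain ⟨L, rfl⟩ := this
    exact ⟨_, prod_mem_degreeLT x S (Nat.lt_succ_self _)⟩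
  | zero => exact ⟨0, zero_mem _⟩
  | add a b _ _ ha hb =>
    obtain ⟨d, hd⟩ := ha
    obtain ⟨e, he⟩ := hb
    exact ⟨max d e, add_mem (degreeLT_mono x S (le_max_left d e) hd)
      (degreeLT_mono x S (le_max_right d e) he)⟩
  | smul c a _ ha =>
    obtain ⟨d, hd⟩ := ha
    exact ⟨d, Submodule.smul_mem _ c hd⟩

/-- A derivation with `N xᵢ = xᵢ` for `i ∈ S` and `N xᵢ = 0` otherwise is the Euler operator. -/
theorem euler_prod {x : ι → A} {S : Finset ι} (N : Derivation ℂ A A)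
    (hN : ∀ i, N (x i) = if i ∈ S then x i else 0) (L : List ι) :
    N (L.map x).prod = (L.countP (· ∈ S) : ℂ) • (L.map x).prod := by
  induction L with
  | nil => simp
  | cons i L ih =>
    rw [List.map_cons, List.prod_cons, Derivation.leibniz, ih, hN]
    by_cases hi : i ∈ S
    · simp only [hi, if_true, List.countP_cons, decide_true, Nat.cast_add, Nat.cast_one, add_smul,
        one_smul, smul_eq_mul, mul_smul_comm]
      rw [mul_comm (x i)]
    · simp [hi]

/-- A derivation with constant values on the generators lowers the degree: a monomial of length
$\ell$ is sent into degrees below $\ell$. -/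
theorem derivation_prod_mem {x : ι → A} [Fintype ι] (D : Derivation ℂ A A)
    (hD : ∀ i, ∃ c : ℂ, D (x i) = c • 1) (L : List ι) :
    D (L.map x).prod ∈ degreeLT x Finset.univ L.length := by
  induction L with
  | nil => simp
  | cons i L ih =>
    rw [List.map_cons, List.prod_cons, Derivation.leibniz]
    obtain ⟨c, hc⟩ := hD i
    refine add_mem ?_ ?_
    · have : degreeLT x Finset.univ L.length ≤
          (degreeLT x Finset.univ (i :: L).length).comap (LinearMap.mulLeft ℂ (x i)) := by
        refine Submodule.span_le.2 ?_
        rintro _ ⟨L', hL', rfl⟩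
        refine prod_mem_degreeLT (L := i :: L') x _ ?_
        simpa using hL'
      exact this ih
    · rw [hc, smul_comm]
      refine Submodule.smul_mem _ c ?_
      rw [smul_eq_mul, mul_one]
      exact prod_mem_degreeLT x _ (by simp)

end Filtration

variable [Fintype ι] [DecidableEq ι]

/-- The Koszul complex of the half-free bimodule `A ⊗ M` is exact in positive degrees. -/
theorem freeOp_exact {x : ι → A} (hx : IsCoordinates x) (X : Bimod A M) {n : ℕ}
    (ω : AltForms ι (A ⊗[ℂ] M) (n + 1)) (hω : contract (freeOp X x) ω = 0) :
    ∃ η, ω = contract (freeOp X x) η := by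
  obtain ⟨D, hD⟩ := hx.exists_partials
  let G : ℕ → Submodule ℂ (A ⊗[ℂ] M) := fun e =>
    Submodule.span ℂ {t | ∃ p ∈ degreeLT x Finset.univ e, ∃ m, t = p ⊗ₜ m}
  have hGm : ∀ {e p} (m : M), p ∈ degreeLT x Finset.univ e → p ⊗ₜ m ∈ G e :=
    fun m hp => Submodule.subset_span ⟨_, hp, m, rfl⟩
  have hmono : Monotone G := fun d e h =>
    Submodule.span_mono fun t ⟨p, hp, m, ht⟩ => ⟨p, degreeLT_mono x _ h hp, m, ht⟩
  -- The derivative carries a minus sign because `freeOp` contains $-x_i\otimes 1$; with it the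
  -- commutators are $\delta_{ij}$.
  obtain ⟨η, ω₀, h, h₀⟩ := IsKoszulCycle.exists_reduced (S := Finset.univ) (T := freeOp X x)
    (D := fun i => -((D i).toLinearMap.rTensor M)) (G := G) (ω := ω) (by
      intro i j
      refine TensorProduct.ext' fun a m => ?_
      simp only [LinearMap.comp_apply, freeOp_tmul, map_sub, ← X.right_mul, mul_comm (x i) (x j),
        ← mul_assoc]
      abel) (by
      intro i j t
      rw [← LinearMap.comp_apply, ← LinearMap.comp_apply, ← LinearMap.sub_apply]
      have : (-((D i).toLinearMap.rTensor M)) ∘ₗ freeOp X x j -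
          freeOp X x j ∘ₗ (-((D i).toLinearMap.rTensor M)) =
          (if i = j then LinearMap.id else 0 : A ⊗[ℂ] M →ₗ[ℂ] A ⊗[ℂ] M) := by
        refine TensorProduct.ext' fun a m => ?_
        simp only [LinearMap.comp_apply, LinearMap.sub_apply, LinearMap.neg_apply, freeOp_tmul,
          map_sub, LinearMap.rTensor_tmul, map_neg, Derivation.coeFn_coe, Derivation.leibniz, hD]
        split_ifs with hij
        · simp only [smul_eq_mul, mul_one, TensorProduct.add_tmul, LinearMap.id_apply]
          abel
        · simp only [mul_zero, add_zero, smul_eq_mul, LinearMap.zero_apply]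
          abel
      rw [this]
      split_ifs with h1 h2 <;> simp_all) (by
      rw [eq_bot_iff]
      refine Submodule.span_le.2 ?_
      rintro _ ⟨p, hp, m, rfl⟩
      rw [degreeLT_zero, Submodule.mem_bot] at hp
      simp [hp]) hmono (by
      intro t
      induction t using TensorProduct.induction_on with
      | zero => exact ⟨0, zero_mem _⟩
      | tmul a m =>
        obtain ⟨e, he⟩ := exists_mem_degreeLT hx.adjoin_eq_top Finset.univ a
        exact ⟨e, hGm m he⟩
      | add s t hs ht =>
        obtain ⟨d, hd⟩ := hs
        obtain ⟨e, he⟩ := ht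
        exact ⟨max d e, add_mem (hmono (le_max_left d e) hd) (hmono (le_max_right d e) he)⟩) (by
      intro d t ht
      let N : A ⊗[ℂ] M →ₗ[ℂ] A ⊗[ℂ] M :=
        ∑ i, freeOp X x i ∘ₗ (-((D i).toLinearMap.rTensor M)) - (d : ℂ) • LinearMap.id
      have hN : ∀ t, N t = ∑ i, freeOp X x i ((-((D i).toLinearMap.rTensor M)) t) -
          (d : ℂ) • t := by
        intro t
        simp [N]
      rw [← hN]
      suffices G (d + 1) ≤ (G d).comap N from this ht
      refine Submodule.span_le.2 ?_
      rintro _ ⟨p, hp, m, rfl⟩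
      suffices degreeLT x Finset.univ (d + 1) ≤
          ((G d).comap N).comap ((TensorProduct.mk ℂ A M).flip m) from this hp
      refine Submodule.span_le.2 ?_
      rintro _ ⟨L, hL, rfl⟩
      have hL' : L.length ≤ d := by simpa [Nat.lt_succ_iff] using hL
      change N ((L.map x).prod ⊗ₜ m) ∈ G d
      have hE := euler_prod (x := x) (S := Finset.univ) (∑ i, x i • D i) (by
        intro j
        simp [derivation_sum_apply, hD]) L
      have hE' : ∑ i, x i * D i (L.map x).prod = (L.length : ℂ) • (L.map x).prod := by
        simpa [derivation_sum_apply] using hE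
      -- The term $x_i\otimes 1$ gives the Euler operator on `A`; the right action on `M` only adds
      -- terms of lower degree in `A`.
      have e1 : N ((L.map x).prod ⊗ₜ m) =
          (L.length : ℂ) • ((L.map x).prod ⊗ₜ m) - (d : ℂ) • ((L.map x).prod ⊗ₜ m) -
          ∑ i, (D i (L.map x).prod) ⊗ₜ X.right (x i) m := by
        rw [hN, TensorProduct.smul_tmul' (L.length : ℂ), ← hE', TensorProduct.sum_tmul]
        simp only [LinearMap.neg_apply, LinearMap.rTensor_tmul, Derivation.coeFn_coe, map_neg,
          freeOp_tmul, neg_sub, Finset.sum_sub_distrib]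
        abel
      rw [e1]
      refine sub_mem ?_ (sum_mem fun i _ => ?_)
      · rcases hL'.lt_or_eq with h | h
        · have hp := hGm m (prod_mem_degreeLT (L := L) x Finset.univ (by simpa using h))
          exact sub_mem (Submodule.smul_mem _ _ hp) (Submodule.smul_mem _ _ hp)
        · rw [h, sub_self]
          exact zero_mem _
      · refine hGm _ (degreeLT_mono x _ hL' (derivation_prod_mem (D i) (fun j => ?_) L))
        exact ⟨if i = j then 1 else 0, by rw [hD]; split_ifs <;> simp⟩) hω
  refine ⟨η, ?_⟩
  have : ω₀ = 0 := by
    refine Module.Basis.ext_alternating (Pi.basisFun ℂ ι) fun J _ => ?_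
    have := h₀ J
    -- The form has degree `n + 1 ≥ 1` and all indices count, so the reduced cycle lies in `G 0 =
    -- ⊥`.
    have hw : 1 - weight Finset.univ J = 0 := by simp [weight]
    rw [hw] at this
    have hG0 : G 0 = ⊥ := by
      rw [eq_bot_iff]
      refine Submodule.span_le.2 ?_
      rintro _ ⟨p, hp, m, rfl⟩
      rw [degreeLT_zero, Submodule.mem_bot] at hp
      simp [hp]
    rw [hG0, Submodule.mem_bot] at this
    simpa [Pi.basisFun_apply] using this
  rw [h, this, add_zero]

/-- Modulo boundaries, $m\otimes ab\equiv ma\otimes b+bm\otimes a$; hence the chains $m\otimes x_i$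
suffice. -/
theorem range_bdry_sup_range_antisymm {x : ι → A} (hx : Algebra.adjoin ℂ (Set.range x) = ⊤)
    (X : Bimod A M) (z : CoeffChains A M 1) :
    z ∈ LinearMap.range (bdry 1 X) ⊔ LinearMap.range (antisymm x 1 (M := M)) := by
  set R := LinearMap.range (bdry 1 X) ⊔ LinearMap.range (antisymm x 1 (M := M)) with hR
  have hlin : ∀ m : M, ∃ f : A →ₗ[ℂ] CoeffChains A M 1, ∀ a, f a = coeffChain m ![a] := by
    intro m
    refine ⟨(splitLast A M 0).symm.toLinearMap ∘ₗ
      (TensorProduct.mk ℂ _ _).flip (PiTensorProduct.tprod ℂ ![]) ∘ₗ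
      TensorProduct.mk ℂ M (Reduced A) m ∘ₗ toReduced A, fun a => ?_⟩
    have := splitLast_symm_coeffChain (A := A) 0 m a ![]
    refine Eq.trans ?_ (this.trans ?_)
    · simp only [LinearMap.comp_apply, coeffChain, LinearMap.flip_apply, TensorProduct.mk_apply,
        LinearEquiv.coe_coe]
      congr 3
      exact Subsingleton.elim _ _
    · congr 1
      funext k
      rw [Fin.fin_one_eq_zero k]
      rfl
  have key : ∀ (a : A) (m : M), coeffChain m ![a] ∈ R := by
    intro a
    have ha : a ∈ Algebra.adjoin ℂ (Set.range x) := by rw [hx]; trivial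
    induction ha using Algebra.adjoin_induction with
    | mem a ha =>
      intro m
      obtain ⟨i, rfl⟩ := ha
      refine Submodule.mem_sup_right ⟨?_, ?_⟩
      · exact AlternatingMap.ofSubsingleton ℂ (ι → ℂ) M (0 : Fin 1)
          ((LinearMap.proj i).smulRight m)
      · rw [antisymm_eq_sum, ← (Equiv.funUnique (Fin 1) ι).symm.sum_comp,
          Finset.sum_eq_single i]
        · simp [coeffChain]
        · intro j _ hj
          simp [coeffChain, hj.symm]
        · simp
    | algebraMap c =>
      intro m
      have : (coeffChain m ![algebraMap ℂ A c] : CoeffChains A M 1) = 0 := by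
        rw [coeffChain]
        have : PiTensorProduct.tprod ℂ
            (fun k => toReduced A ((![algebraMap ℂ A c] : Fin 1 → A) k)) = 0 :=
          MultilinearMap.map_coord_zero _ 0 (toReduced_algebraMap c)
        rw [this, TensorProduct.tmul_zero]
      rw [this]
      exact zero_mem _
    | add a b _ _ ha hb =>
      intro m
      obtain ⟨f, hf⟩ := hlin m
      rw [← hf, map_add, hf, hf]
      exact add_mem (ha m) (hb m)
    | mul a b _ _ ha hb =>
      intro m
      have h := bdry_coeffChain 1 X m ![a, b]
      have h' : coeffChain m ![a * b] = coeffChain (X.right a m) ![b] +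
          coeffChain (X.left b m) ![a] - bdry 1 X (coeffChain m ![a, b]) := by
        rw [h, Fin.sum_univ_three]
        have e0 : faceArgs 0 ![a, b] = ![b] := by funext k; simp [faceArgs, Fin.fin_one_eq_zero k]
        have e1 : faceArgs 1 ![a, b] = ![a * b] := by
          funext k; simp [faceArgs, Fin.fin_one_eq_zero k]
        have e2 : faceArgs 2 ![a, b] = ![a] := by funext k; simp [faceArgs, Fin.fin_one_eq_zero k]
        have c0 : faceCoeff X 0 m ![a, b] = X.right a m := by simp [faceCoeff]
        have c1 : faceCoeff X 1 m ![a, b] = m := by simp [faceCoeff, Fin.ext_iff]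
        have c2 : faceCoeff X 2 m ![a, b] = X.left b m := by simp [faceCoeff, Fin.ext_iff]
        rw [e0, e1, e2, c0, c1, c2]
        simp
      rw [h']
      exact sub_mem (add_mem (hb _) (ha _)) (Submodule.mem_sup_left ⟨_, rfl⟩)
  have : (⊤ : Submodule ℂ (CoeffChains A M 1)) ≤ R := by
    have hq : R.mkQ = 0 := coeffChains_ext fun m a => by
      rw [LinearMap.zero_apply, Submodule.mkQ_apply, Submodule.Quotient.mk_eq_zero]
      have : a = ![a 0] := by funext k; simp [Fin.fin_one_eq_zero k]
      rw [this]
      exact key _ _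
    rw [← Submodule.ker_mkQ R, hq, LinearMap.ker_zero]
  exact this trivial

/-- Each Hochschild cycle is homologous to the antisymmetrization of a Koszul cycle. -/
theorem exists_antisymm_of_cycle {x : ι → A} (hx : IsCoordinates x) (n : ℕ) :
    ∀ {M : Type u} [AddCommGroup M] [Module ℂ M] (X : Bimod A M) (z : CoeffChains A M (n + 1)),
      bdry n X z = 0 → ∃ (w : CoeffChains A M (n + 2)) (ω : AltForms ι M (n + 1)),
        contract (X.koszulOp x) ω = 0 ∧ z = bdry (n + 1) X w + antisymm x (n + 1) ω := by
  induction n with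
  | zero =>
    intro M _ _ X z hz
    obtain ⟨_, ⟨w, rfl⟩, _, ⟨ω, rfl⟩, rfl⟩ :=
      Submodule.mem_sup.1 (range_bdry_sup_range_antisymm hx.adjoin_eq_top X z)
    refine ⟨w, ω, ?_, rfl⟩
    rw [map_add, bdry_bdry, zero_add, bdry_antisymm, pow_zero, one_smul, antisymm_zero_apply] at hz
    ext v
    -- In degree zero antisymmetrization is the identification $M\cong M\otimes\mathbb{C}$, hence
    -- injective.
    have h1 := congrArg (TensorProduct.rid ℂ M ∘ TensorProduct.congr (LinearEquiv.refl ℂ M)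
      (PiTensorProduct.isEmptyEquiv (Fin 0))) hz
    have h2 : contract (X.koszulOp x) ω ![] = 0 := by
      simpa [coeffChain] using h1
    rw [Subsingleton.elim v ![], h2]
    rfl
  | succ n ih =>
    intro M _ _ X z hz
    rw [bdry_succ_apply, LinearEquiv.map_eq_zero_iff] at hz
    obtain ⟨w, ω, hω, hz'⟩ := ih X.shift _ hz
    -- The connecting map run backwards: `ω` becomes exact in the Koszul complex of $A\otimes M$,
    -- and the image of a primitive under `act` is a cycle for `M`, one degree higher.
    obtain ⟨η, hη⟩ := freeOp_exact hx X (X.incl.compAlternatingMap ω) (by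
      rw [contract_comp]
      simp only [freeOp_comp_incl]
      rw [← comp_contract, hω]
      ext v
      simp)
    -- Thus `ω` is homologous to the negative contraction of `act ∘ η` against the $x_i$, which
    -- antisymmetrizes to the antisymmetrization of `-act ∘ η` with its last factor split off.
    have h1 : contract (X.shift.koszulOp x) ((reduceLeft A M).compAlternatingMap η) =
        ω + contract (fun i => tensorRight M (x i)) (X.act.compAlternatingMap η) := by
      rw [contract_comp, contract_comp]
      have : ω = contract (fun i => reduceLeft A M ∘ₗ freeOp X x i) η := by
        rw [← comp_contract, ← hη]
        ext v
        have := LinearMap.congr_fun (reduceLeft_comp_incl X) (ω v)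
        simpa using this.symm
      conv_rhs => rw [this]
      ext v
      simp [contract_apply, koszulOp_comp_reduceLeft, Finset.sum_add_distrib]
    have h2 := bdry_antisymm x (n + 1) X.shift ((reduceLeft A M).compAlternatingMap η)
    rw [h1, map_add] at h2
    refine ⟨(splitLast A M (n + 2)).symm (w + (-1 : ℂ) ^ (n + 1) •
      antisymm x (n + 2) ((reduceLeft A M).compAlternatingMap η)),
      -X.act.compAlternatingMap η, ?_, ?_⟩
    · rw [map_neg, contract_comp]
      simp only [← act_comp_freeOp]
      rw [← comp_contract, ← hη]
      ext v
      have := LinearMap.congr_fun (act_comp_incl X) (ω v)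
      simpa using this
    · rw [← (splitLast A M (n + 1)).injective.eq_iff, hz', map_add, bdry_succ_apply X,
        LinearEquiv.apply_symm_apply, LinearEquiv.apply_symm_apply, map_add, map_smul, h2,
        antisymm_succ_apply x (n + 1), LinearEquiv.apply_symm_apply, map_neg, map_neg, smul_smul,
        ← mul_pow]
      simp
      abel

end Surjectivity

/-! ### Antisymmetrization by Kronecker determinants. -/

section Determinants

theorem sum_det_smul {ι R N : Type*} [Fintype ι] [DecidableEq ι] [CommRing R] [AddCommGroup N]
    [Module R N] {n : ℕ} (K : Fin n → ι) (F : (Fin n → ι) → N)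
    (hF : ∀ σ : Equiv.Perm (Fin n), F (fun k => K (σ k)) = (Equiv.Perm.sign σ : ℤ) • F K) :
    ∑ J : Fin n → ι, (Matrix.of fun b a => if K a = J b then (1 : R) else 0).det • F J =
      (n.factorial : R) • F K := by
  simp only [Matrix.det_apply', Matrix.of_apply, Finset.sum_smul]
  rw [Finset.sum_comm]
  have h : ∀ σ : Equiv.Perm (Fin n), ∑ J : Fin n → ι, (((Equiv.Perm.sign σ : ℤ) : R) *
      ∏ i, if K i = J (σ i) then (1 : R) else 0) • F J = F K := by
    intro σ
    -- After expanding the determinant, each permutation selects one `J`; its sign cancels the sign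
    -- of `F`, so each of the $n!$ permutations contributes `F K`.
    rw [Finset.sum_eq_single fun k => K (σ⁻¹ k)]
    · have e : ∀ i, (if K i = K (σ⁻¹ (σ i)) then (1 : R) else 0) = 1 := fun i => by simp
      rw [hF, Finset.prod_congr rfl fun i _ => e i, Finset.prod_const_one, mul_one,
        ← Int.cast_smul_eq_zsmul R, smul_smul, Equiv.Perm.sign_inv, ← Int.cast_mul,
        ← Units.val_mul, Int.units_mul_self]
      simp
    · intro J _ hJ
      have : ∃ i, K i ≠ J (σ i) := by
        by_contra! h
        refine hJ (funext fun k => ?_)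
        simp [h]
      obtain ⟨i, hi⟩ := this
      rw [Finset.prod_eq_zero (Finset.mem_univ i) (if_neg hi), mul_zero, zero_smul]
    · simp
  rw [Finset.sum_congr rfl fun σ _ => h σ, Finset.sum_const, Finset.card_univ,
    Fintype.card_perm, Fintype.card_fin, Nat.cast_smul_eq_nsmul]

theorem altMap_comp_perm {R V N : Type*} [CommRing R] [AddCommGroup V] [Module R V]
    [AddCommGroup N] [Module R N] {n : ℕ} (f : V [⋀^Fin n]→ₗ[R] N) (v : Fin n → V)
    (σ : Equiv.Perm (Fin n)) :
    f (fun k => v (σ k)) = (Equiv.Perm.sign σ : ℤ) • f v :=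
  f.map_perm v σ

end Determinants

/-! ### Twisted HKR on chains, in adapted coordinates. -/

section HochschildKostantRosenberg

variable {A B : Type u} [CommRing A] [Algebra ℂ A] [CommRing B] [Algebra ℂ B]
theorem koszulOp_twisted_apply {ι : Type*} (g : A →ₐ[ℂ] A) (x : ι → A) (i : ι) (a : A) :
    (Bimod.twisted g).koszulOp x i a = (g (x i) - x i) * a := by
  rw [sub_mul]; rfl

variable {ι : Type*} [Fintype ι] [DecidableEq ι]

/-- Coordinates `x` on `A` adapted to an endomorphism `g` and a quotient `φ : A → B`: those with
index outside `S` are fixed by `g` and restrict to coordinates of `B`, those with index in `S`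
vanish in `B`, and the functions `g xᵢ - xᵢ`, `i ∈ S`, are linear coordinates in the directions
of `S`. -/
structure IsAdapted (φ : A →ₐ[ℂ] B) (g : A →ₐ[ℂ] A) (x : ι → A) (S : Finset ι) : Prop where
  coord : IsCoordinates x
  fixed : ∀ i ∉ S, g (x i) = x i
  vanish : ∀ i ∈ S, φ (x i) = 0
  transversal : ∃ D : ι → Derivation ℂ A A,
    (∀ i j, D i (g (x j) - x j) = if i = j ∧ i ∈ S then 1 else 0) ∧
    ∀ j, ∑ i, (g (x i) - x i) * D i (x j) = if j ∈ S then x j else 0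
  partials : ∃ d : ι → Derivation ℂ B B, ∀ i ∉ S, ∀ j, d i (φ (x j)) = if i = j then 1 else 0
  splitting : ∃ σ : B →ₐ[ℂ] A, (∀ b, φ (σ b) = b) ∧ ∀ i ∉ S, σ (φ (x i)) = x i

variable {φ : A →ₐ[ℂ] B} {g : A →ₐ[ℂ] A} {x : ι → A} {S : Finset ι}

/-- Koszul cycles of the twisted bimodule may be moved into the fixed directions. -/
theorem IsAdapted.exists_reduced (h : IsAdapted φ g x S) {n : ℕ} (ω : AltForms ι A n)
    (hω : IsKoszulCycle ((Bimod.twisted g).koszulOp x) ω) :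
    ∃ (η : AltForms ι A (n + 1)) (ω₀ : AltForms ι A n),
      ω = contract ((Bimod.twisted g).koszulOp x) η + ω₀ ∧
      ∀ J : Fin n → ι, ω₀ (fun k => stdVec (J k)) ∈ degreeLT x S (1 - weight S J) := by
  obtain ⟨D, hD, hN⟩ := h.transversal
  refine IsKoszulCycle.exists_reduced (D := fun i => (D i).toLinearMap) ?_ ?_ (degreeLT x S)
    (degreeLT_zero x S) (degreeLT_mono x S) (exists_mem_degreeLT h.coord.adjoin_eq_top S) ?_ ω hω
  · intro i j
    ext a
    simp only [LinearMap.comp_apply, koszulOp_twisted_apply]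
    ring
  · intro i j a
    simp only [koszulOp_twisted_apply, Derivation.coeFn_coe, Derivation.leibniz, hD, smul_eq_mul]
    split_ifs <;> ring
  · intro d a ha
    -- Since the Koszul operators are multiplications, $\sum_iT_iD_i$ is itself a derivation; the
    -- second part of `transversal` makes it the Euler field of the directions in `S`.
    let N : Derivation ℂ A A := ∑ i, (g (x i) - x i) • D i
    have hN' : ∀ a, N a = ∑ i, (g (x i) - x i) * D i a := by
      intro a
      simp [N, derivation_sum_apply]
    let L₀ : A →ₗ[ℂ] A := N.toLinearMap - (d : ℂ) • LinearMap.id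
    suffices degreeLT x S (d + 1) ≤ (degreeLT x S d).comap L₀ by
      have := this ha
      simpa [L₀, hN', koszulOp_twisted_apply] using this
    refine Submodule.span_le.2 ?_
    rintro _ ⟨L, hL, rfl⟩
    have hE := euler_prod N (fun j => (hN' _).trans (hN j)) L
    change N (L.map x).prod - (d : ℂ) • (L.map x).prod ∈ degreeLT x S d
    rw [hE]
    rcases (Nat.lt_succ_iff.1 hL).lt_or_eq with hlt | heq
    · have := prod_mem_degreeLT x S hlt
      exact sub_mem (Submodule.smul_mem _ _ this) (Submodule.smul_mem _ _ this)
    · rw [heq, sub_self]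
      exact zero_mem _

theorem chiChains_antisymm (φ : A →ₐ[ℂ] B) (x : ι → A) {n : ℕ} (ω : AltForms ι A n) :
    chiChains φ n (antisymm x n ω) = (n.factorial : ℂ)⁻¹ • ∑ J : Fin n → ι,
      φ (ω fun k => stdVec (J k)) • exteriorPower.ιMulti B n
        fun k => KaehlerDifferential.D ℂ B (φ (x (J k.rev))) := by
  rw [antisymm_eq_sum, map_sum, Finset.smul_sum]
  exact Finset.sum_congr rfl fun J _ => chiChains_chain φ (ω fun k => stdVec (J k), _)

/-- On the reduced Koszul cycles the Hochschild–Kostant–Rosenberg map is injective. -/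
theorem IsAdapted.eq_zero_of_chiChains (h : IsAdapted φ g x S) {n : ℕ} (ω : AltForms ι A n)
    (hω : ∀ J : Fin n → ι, ω (fun k => stdVec (J k)) ∈ degreeLT x S (1 - weight S J))
    (hχ : chiChains φ n (antisymm x n ω) = 0) : ω = 0 := by
  obtain ⟨d, hd⟩ := h.partials
  obtain ⟨σ, _, hσ⟩ := h.splitting
  have hfac : (n.factorial : ℂ) ≠ 0 := Nat.cast_ne_zero.2 n.factorial_ne_zero
  rw [chiChains_antisymm, smul_eq_zero, or_iff_right (inv_ne_zero hfac)] at hχ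
  refine Module.Basis.ext_alternating (Pi.basisFun ℂ ι) fun K _ => ?_
  simp only [Pi.basisFun_apply, AlternatingMap.zero_apply]
  by_cases hK : ∃ k, K k ∈ S
  · obtain ⟨k, hk⟩ := hK
    -- A transversal index forces the coefficient into filtration degree zero, so it vanishes.
    have hw : 1 - weight S K = 0 := by
      have : 0 < weight S K := Finset.card_pos.2 ⟨k, by simp [hk]⟩
      omega
    have := hω K
    rwa [hw, degreeLT_zero, Submodule.mem_bot] at this
  push Not at hK
  have hw : weight S K = 0 := by simp [weight, hK]
  have hmem := hω K
  rw [hw] at hmem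
  -- Degree below one in `S` means a polynomial in the fixed coordinates, and there `σ ∘ φ` is the
  -- identity; so it suffices that `φ` kills the coefficient.
  have hfix : degreeLT x S (1 - 0) ≤
      LinearMap.eqLocus (σ.toLinearMap ∘ₗ φ.toLinearMap) LinearMap.id := by
    refine Submodule.span_le.2 ?_
    rintro _ ⟨L, hL, rfl⟩
    have hL' : ∀ i ∈ L, i ∉ S := by simpa [Nat.lt_one_iff, List.countP_eq_zero] using hL
    change σ (φ (L.map x).prod) = (L.map x).prod
    rw [map_list_prod, map_list_prod, List.map_map, List.map_map]
    congr 1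
    exact List.map_congr_left fun i hi => hσ i (hL' i hi)
  have hσφ : σ (φ (ω fun k => stdVec (K k))) = ω fun k => stdVec (K k) := hfix hmem
  suffices φ (ω fun k => stdVec (K k)) = 0 by rw [← hσφ, this, map_zero]
  -- Pairing with the wedge of the partials $d_K$ extracts $n!$ times the coefficient at `K`; the
  -- reversal matches the one in `antisymm_eq_sum`.
  have hpair := congrArg (exteriorPower.pairingDual B (Ω[B⁄ℂ]) n (exteriorPower.ιMulti B n
    fun a => (d (K a.rev)).liftKaehlerDifferential)) hχ
  have hdet := sum_det_smul (R := B) (N := B) (fun a => K a.rev)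
    (fun J => φ (ω fun k => stdVec (J k.rev))) (fun τ => by
      rw [← map_zsmul]
      exact congrArg φ (altMap_comp_perm (ω.domDomCongr Fin.revPerm)
        (fun k => stdVec (K k.rev)) τ))
  rw [map_zero, map_sum] at hpair
  rw [← (Equiv.arrowCongr Fin.revPerm (Equiv.refl ι)).sum_comp] at hpair
  have e : ∀ J : Fin n → ι, (exteriorPower.pairingDual B (Ω[B⁄ℂ]) n (exteriorPower.ιMulti B n
      fun a => (d (K a.rev)).liftKaehlerDifferential))
      (φ (ω fun k => stdVec (Equiv.arrowCongr Fin.revPerm (Equiv.refl ι) J k)) •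
        exteriorPower.ιMulti B n fun k => KaehlerDifferential.D ℂ B
          (φ (x (Equiv.arrowCongr Fin.revPerm (Equiv.refl ι) J k.rev)))) =
      (Matrix.of fun b a => if K a.rev = J b then (1 : B) else 0).det •
        φ (ω fun k => stdVec (J k.rev)) := by
    intro J
    rw [map_smul, exteriorPower.pairingDual_ιMulti_ιMulti, smul_eq_mul, smul_eq_mul, mul_comm]
    congr 2
    · ext b a
      simp [hd _ (hK _)]
  rw [Finset.sum_congr rfl fun J _ => e J, hdet] at hpair
  have hB : IsUnit (n.factorial : B) := by
    have := (IsUnit.mk0 _ hfac).map (algebraMap ℂ B)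
    simpa using this
  simpa using (hB.smul_eq_zero).1 hpair

/-- A chain is a cycle if it has degree zero or its boundary vanishes. -/
def IsHochschildCycle (g : A →ₐ[ℂ] A) : {n : ℕ} → Chains A n → Prop
  | 0, _ => True
  | n + 1, z => boundary g n z = 0

/-- A cycle is replaced by an antisymmetrized Koszul cycle, then by a reduced one. The discarded
terms are boundaries, so `chiChains` still vanishes on what remains and forces it to be zero. -/
theorem IsAdapted.exists_boundary (h : IsAdapted φ g x S) (hφ : φ.comp g = φ) {n : ℕ}
    (z : Chains A n) (hz : IsHochschildCycle g z) (hχ : chiChains φ n z = 0) :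
    ∃ w, boundary g n w = z := by
  have h1 : ∃ (w : Chains A (n + 1)) (ω : AltForms ι A n),
      IsKoszulCycle ((Bimod.twisted g).koszulOp x) ω ∧ z = boundary g n w + antisymm x n ω := by
    cases n with
    | zero =>
      let e : Chains A 0 ≃ₗ[ℂ] A := TensorProduct.congr (LinearEquiv.refl ℂ A)
        (PiTensorProduct.isEmptyEquiv (Fin 0)) ≪≫ₗ TensorProduct.rid ℂ A
      refine ⟨0, AlternatingMap.constOfIsEmpty ℂ (ι → ℂ) (Fin 0) (e z), trivial, ?_⟩
      rw [map_zero, zero_add, antisymm_zero_apply, ← e.injective.eq_iff]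
      simp [coeffChain, e]
    | succ n =>
      have hz' : bdry n (Bimod.twisted g) z = 0 := by
        rw [← boundary_eq_bdry]; exact hz
      obtain ⟨w, ω, hω, e⟩ := exists_antisymm_of_cycle h.coord n (Bimod.twisted g) z hz'
      refine ⟨w, ω, hω, ?_⟩
      rw [boundary_eq_bdry]
      exact e
  obtain ⟨w, ω, hω, rfl⟩ := h1
  obtain ⟨η, ω₀, rfl, hω₀⟩ := h.exists_reduced ω hω
  have hb : antisymm x n (contract ((Bimod.twisted g).koszulOp x) η) =
      boundary g n ((-1 : ℂ) ^ n • antisymm x (n + 1) η) := by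
    have e : (-1 : ℂ) ^ n * (-1) ^ n = 1 := by rw [← mul_pow]; simp
    rw [map_smul, boundary_eq_bdry, bdry_antisymm, smul_smul, e, one_smul]
  have hχb : ∀ w, chiChains φ n (boundary g n w) = 0 :=
    LinearMap.congr_fun (chiChains_boundary φ g hφ n)
  rw [map_add (antisymm x n), hb] at hχ ⊢
  rw [map_add, map_add, hχb, hχb, zero_add, zero_add] at hχ
  rw [h.eq_zero_of_chiChains ω₀ hω₀ hχ, map_zero, add_zero]
  exact ⟨_, map_add _ _ _⟩

/-- The section `σ` makes `φ` surjective, so the $d\varphi(x_i)$ span the differentials; those with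
$i\in S$ are zero. -/
theorem IsAdapted.span_forms (h : IsAdapted φ g x S) (n : ℕ) :
    Submodule.span B {θ : Forms B n | ∃ K : Fin n → ι, (∀ k, K k ∉ S) ∧
      θ = exteriorPower.ιMulti B n fun k => KaehlerDifferential.D ℂ B (φ (x (K k)))} = ⊤ := by
  obtain ⟨σ, hσ, _⟩ := h.splitting
  let s : Set (Ω[B⁄ℂ]) := {η | ∃ i ∉ S, η = KaehlerDifferential.D ℂ B (φ (x i))}
  have hs : Submodule.span B s = ⊤ := by
    rw [eq_top_iff, ← KaehlerDifferential.span_range_derivation, Submodule.span_le]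
    rintro _ ⟨b, rfl⟩
    have key : ∀ a : A, KaehlerDifferential.D ℂ B (φ a) ∈ Submodule.span B s := by
      intro a
      have ha : a ∈ Algebra.adjoin ℂ (Set.range x) := by rw [h.coord.adjoin_eq_top]; trivial
      induction ha using Algebra.adjoin_induction with
      | mem a ha =>
        obtain ⟨i, rfl⟩ := ha
        by_cases hi : i ∈ S
        · rw [h.vanish i hi, map_zero]
          exact zero_mem _
        · exact Submodule.subset_span ⟨i, hi, rfl⟩
      | algebraMap c => simp
      | add a b _ _ ha hb =>
        rw [map_add, map_add]
        exact add_mem ha hb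
      | mul a b _ _ ha hb =>
        rw [map_mul, Derivation.leibniz]
        exact add_mem (Submodule.smul_mem _ _ hb) (Submodule.smul_mem _ _ ha)
    rw [← hσ b]
    exact key _
  rw [eq_top_iff, ← exteriorPower.ιMulti_span_of_span B n (Ω[B⁄ℂ]) hs]
  refine Submodule.span_mono ?_
  rintro _ ⟨v, hv, rfl⟩
  have : ∀ k, v k ∈ s := fun k => hv ⟨k, rfl⟩
  choose K hK hv' using this
  exact ⟨K, hK, by congr 1; funext k; exact hv' k⟩

theorem IsAdapted.exists_cycle (h : IsAdapted φ g x S) {n : ℕ} (θ : Forms B n) :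
    ∃ z : Chains A n, IsHochschildCycle g z ∧ chiChains φ n z = θ := by
  obtain ⟨σ, hσ, _⟩ := h.splitting
  have key : ∀ (b : B) (K : Fin n → ι), (∀ k, K k ∉ S) →
      ∃ z : Chains A n, IsHochschildCycle g z ∧ chiChains φ n z = b •
        exteriorPower.ιMulti B n fun k => KaehlerDifferential.D ℂ B (φ (x (K k))) := by
    intro b K hK
    -- The candidate lift of $b\,dx_K$ is $\sigma(b)$ times the determinant form of the coordinates
    -- in `K`.
    let ω : AltForms ι A n := (LinearMap.toSpanSingleton ℂ A (σ b)).compAlternatingMap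
      ((Matrix.detRowAlternating (R := ℂ) (n := Fin n)).compLinearMap
        (LinearMap.funLeft ℂ ℂ fun k => K k.rev))
    have hω : ∀ v, ω v = (Matrix.of fun k a => v k (K a.rev)).det • σ b := fun v => rfl
    refine ⟨antisymm x n ω, ?_, ?_⟩
    · cases n with
      | zero => trivial
      | succ n =>
        change boundary g n (antisymm x (n + 1) ω) = 0
        rw [boundary_eq_bdry, bdry_antisymm]
        have : contract ((Bimod.twisted g).koszulOp x) ω = 0 := by
          ext v
          rw [contract_apply, AlternatingMap.zero_apply]
          refine Finset.sum_eq_zero fun i _ => ?_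
          rw [koszulOp_twisted_apply]
          -- For $i\in S$ the form has no $i$-component, as `K` avoids `S`; for $i\notin S$ the
          -- Koszul operator is zero.
          by_cases hi : i ∈ S
          · rw [hω, Matrix.det_eq_zero_of_row_eq_zero 0, zero_smul, mul_zero]
            intro a
            have : K a.rev ≠ i := fun e => hK _ (e ▸ hi)
            simp [this]
          · rw [h.fixed i hi, sub_self, zero_mul]
        rw [this, map_zero, smul_zero]
    · rw [chiChains_antisymm]
      have hdet := sum_det_smul (R := B) (fun a => K a.rev)
        (fun J => b • exteriorPower.ιMulti B n fun k =>
          KaehlerDifferential.D ℂ B (φ (x (J k.rev)))) (fun τ => by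
          rw [smul_comm]
          exact congrArg (b • ·) (altMap_comp_perm
            ((exteriorPower.ιMulti B n (M := Ω[B⁄ℂ])).domDomCongr Fin.revPerm)
            (fun k => KaehlerDifferential.D ℂ B (φ (x (K k.rev)))) τ))
      have e : ∀ J : Fin n → ι, φ (ω fun k => stdVec (J k)) =
          (Matrix.of fun b a => if K a.rev = J b then (1 : B) else 0).det * b := by
        intro J
        rw [hω, map_smul, hσ, Algebra.smul_def, RingHom.map_det]
        congr 2
        ext k a
        by_cases hka : K a.rev = J k <;> simp [Pi.single_apply, hka]
      simp only [e, mul_smul]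
      rw [hdet, Nat.cast_smul_eq_nsmul, ← Nat.cast_smul_eq_nsmul ℂ, smul_smul,
        inv_mul_cancel₀ (Nat.cast_ne_zero.2 n.factorial_ne_zero), one_smul]
      simp only [Fin.rev_rev]
  have htop : θ ∈ Submodule.span B {θ : Forms B n | ∃ K : Fin n → ι, (∀ k, K k ∉ S) ∧
      θ = exteriorPower.ιMulti B n fun k => KaehlerDifferential.D ℂ B (φ (x (K k)))} := by
    rw [h.span_forms n]; trivial
  have hadd : ∀ z z' : Chains A n, IsHochschildCycle g z → IsHochschildCycle g z' →
      IsHochschildCycle g (z + z') := by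
    intro z z' hz hz'
    cases n with
    | zero => trivial
    | succ n =>
      have e : boundary g n z = 0 := hz
      have e' : boundary g n z' = 0 := hz'
      change boundary g n (z + z') = 0
      rw [map_add, e, e', add_zero]
  -- Quantifying over multiples makes the span induction work over `B`, although cycles are only
  -- known to be closed under addition.
  suffices ∀ b : B, ∃ z : Chains A n, IsHochschildCycle g z ∧ chiChains φ n z = b • θ by
    simpa using this 1
  induction htop using Submodule.span_induction with
  | mem θ hθ =>
    obtain ⟨K, hK, rfl⟩ := hθ
    exact fun b => key b K hK
  | zero =>
    intro b
    refine ⟨0, ?_, by simp⟩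
    cases n with
    | zero => trivial
    | succ n => exact map_zero (boundary g n)
  | add θ θ' _ _ hθ hθ' =>
    intro b
    obtain ⟨z, hz, e⟩ := hθ b
    obtain ⟨z', hz', e'⟩ := hθ' b
    exact ⟨z + z', hadd z z' hz hz', by rw [map_add, e, e', smul_add]⟩
  | smul c θ _ hθ =>
    intro b
    obtain ⟨z, hz, e⟩ := hθ (b * c)
    exact ⟨z, hz, by rw [e, mul_smul]⟩

end HochschildKostantRosenberg

/-! ### Passage from cycles and boundaries to homology. -/

section Homology

variable {A B : Type u} [CommRing A] [Algebra ℂ A] [CommRing B] [Algebra ℂ B]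
variable {ι : Type*} [Fintype ι] [DecidableEq ι]
variable {φ : A →ₐ[ℂ] B} {g : A →ₐ[ℂ] A} {x : ι → A} {S : Finset ι}

theorem isHochschildCycle_iff {A : Type u} [CommRing A] [Algebra ℂ A] (g : A →ₐ[ℂ] A) {q : ℕ}
    (z : (hochschildComplex A g).X q) :
    IsHochschildCycle g (z : Chains A q) ↔
      (hochschildComplex A g).d q ((ComplexShape.down ℕ).next q) z = 0 := by
  cases q with
  | zero =>
    rw [HomologicalComplex.shape _ _ _ (by simp)]
    exact ⟨fun _ => rfl, fun _ => trivial⟩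
  | succ q =>
    have : (ComplexShape.down ℕ).next (q + 1) = q := ChainComplex.next_nat_succ q
    rw [this, hochschildComplex_d]
    rfl

/-- The twisted Hochschild–Kostant–Rosenberg theorem in adapted coordinates. -/
theorem IsAdapted.isIso_chi (h : IsAdapted φ g x S) (hφ : φ.comp g = φ) (q : ℕ) :
    IsIso (chi φ g hφ q) := by
  let C := hochschildComplex A g
  have hπ : ∀ c, chi φ g hφ q (C.homologyπ q c) = chiChains φ q (C.iCycles q c) := fun c =>
    ConcreteCategory.congr_hom (homologyπ_chi φ g hφ q) c
  refine (ConcreteCategory.isIso_iff_bijective _).2 ⟨?_, fun θ => ?_⟩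
  · refine (injective_iff_map_eq_zero (chi φ g hφ q).hom).2 fun y hy => ?_
    obtain ⟨c, rfl⟩ := (ModuleCat.epi_iff_surjective (C.homologyπ q)).1 inferInstance y
    have hy' : chiChains φ q (C.iCycles q c) = 0 := (hπ c).symm.trans hy
    obtain ⟨w, hw⟩ := h.exists_boundary hφ (C.iCycles q c) ((isHochschildCycle_iff g _).2 (by
      exact ConcreteCategory.congr_hom (C.iCycles_d q ((ComplexShape.down ℕ).next q)) c)) hy'
    have hc : C.toCycles (q + 1) q w = c := by
      refine (ModuleCat.mono_iff_injective (C.iCycles q)).1 inferInstance ?_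
      refine (ConcreteCategory.congr_hom (C.toCycles_i (q + 1) q) w).trans (Eq.trans ?_ hw)
      exact ConcreteCategory.congr_hom (hochschildComplex_d g q) w
    rw [← hc]
    exact ConcreteCategory.congr_hom (C.toCycles_comp_homologyπ (q + 1) q) w
  · obtain ⟨z, hz, e⟩ := h.exists_cycle (n := q) θ
    have hz' := (isHochschildCycle_iff g z).1 hz
    refine ⟨C.homologyπ q (C.cyclesMk (i := q) z _ rfl hz'), ?_⟩
    rw [hπ]
    refine Eq.trans ?_ e
    congr 1
    exact C.i_cyclesMk (i := q) z _ rfl hz'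

theorem mapHH_comp_chi (φ : A →ₐ[ℂ] B) (g : A →ₐ[ℂ] A) (hφ : φ.comp g = φ)
    (hφ' : φ.comp g = (AlgHom.id ℂ B).comp φ) (q : ℕ) :
    mapHH φ g (AlgHom.id ℂ B) hφ' q ≫ chi (AlgHom.id ℂ B) (AlgHom.id ℂ B) (AlgHom.id_comp _) q =
      chi φ g hφ q := by
  rw [← cancel_epi ((hochschildComplex A g).homologyπ q), homologyπ_chi, mapHH,
    HomologicalComplex.homologyπ_naturality_assoc, homologyπ_chi,
    HomologicalComplex.cyclesMap_i_assoc]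
  congr 1
  have : chiChains (AlgHom.id ℂ B) q ∘ₗ chainsMap φ q = chiChains φ q := chains_ext fun y => by
    rw [LinearMap.comp_apply, chainsMap_chain, chiChains_chain, chiChains_chain]
    rfl
  exact congrArg ModuleCat.ofHom this

end Homology

/-! ### Linear coordinates on polynomial functions. -/

section PolynomialFunctions

variable {E : Type u} [AddCommGroup E] [Module ℂ E]

/-- A linear form as a polynomial function. -/
def linearForm (ξ : Module.Dual ℂ E) : polyFun E :=
  ⟨ξ, Algebra.subset_adjoin ⟨ξ, rfl⟩⟩

theorem linearForm_apply (ξ : Module.Dual ℂ E) (v : E) : (linearForm ξ : E → ℂ) v = ξ v := rfl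

theorem linearForm_add (ξ η : Module.Dual ℂ E) :
    linearForm (ξ + η) = linearForm ξ + linearForm η := rfl

theorem linearForm_smul (c : ℂ) (ξ : Module.Dual ℂ E) :
    linearForm (c • ξ) = c • linearForm ξ := rfl

variable {ι : Type*} [Fintype ι]

/-- The coordinate functions of a basis are coordinates on the algebra of polynomial functions. -/
theorem isCoordinates_coord (b : Module.Basis ι ℂ E) :
    IsCoordinates fun i => linearForm (b.coord i) := by
  have hadj : Algebra.adjoin ℂ (Set.range fun i => linearForm (b.coord i)) = ⊤ := by
    have hle : polyFun E ≤
        (Algebra.adjoin ℂ (Set.range fun i => linearForm (b.coord i))).map (polyFun E).val := by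
      refine Algebra.adjoin_le ?_
      rintro _ ⟨ξ, rfl⟩
      refine ⟨∑ i, ξ (b i) • linearForm (b.coord i), sum_mem fun i _ =>
        Subalgebra.smul_mem _ (Algebra.subset_adjoin (Set.mem_range_self i)) _, ?_⟩
      funext v
      change _ = ξ v
      conv_rhs => rw [← b.sum_repr v, map_sum]
      simp [linearForm_apply, mul_comm]
    rw [eq_top_iff]
    intro p _
    obtain ⟨p', hp', e⟩ := hle p.2
    rwa [← Subtype.ext (a1 := p') (a2 := p) e]
  refine ⟨hadj, fun c => ?_⟩
  let f : MvPolynomial ι ℂ →ₐ[ℂ] polyFun E := MvPolynomial.aeval fun i => linearForm (b.coord i)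
  have hsurj : Function.Surjective f := by
    rw [← AlgHom.range_eq_top, ← hadj, Algebra.adjoin_range_eq_range_aeval]
  have hinj : Function.Injective f := by
    rw [injective_iff_map_eq_zero]
    intro p hp
    -- Over the infinite field $\mathbb{C}$ a polynomial is determined by its values, so polynomial
    -- functions form a free polynomial algebra and derivations can be prescribed on the
    -- coordinates.
    refine MvPolynomial.funext fun v => ?_
    have h1 : ∀ p, (f p : E → ℂ) (b.equivFun.symm v) = MvPolynomial.eval v p := by
      intro p
      induction p using MvPolynomial.induction_on with
      | C a => simp [f]
      | add p q hp hq => simp [← hp, ← hq]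
      | mul_X p i hp =>
        have hX : f (MvPolynomial.X i) = linearForm (b.coord i) := MvPolynomial.aeval_X _ i
        rw [map_mul, map_mul, ← hp, hX, MvPolynomial.eval_X]
        change _ * b.coord i (b.equivFun.symm v) = _
        rw [Module.Basis.coord_apply, ← Module.Basis.equivFun_apply, LinearEquiv.apply_symm_apply]
    rw [← h1, hp]
    simp
  let e : MvPolynomial ι ℂ ≃ₐ[ℂ] polyFun E := AlgEquiv.ofBijective f ⟨hinj, hsurj⟩
  let D := MvPolynomial.mkDerivation ℂ fun i => e.symm (c i)
  refine ⟨Derivation.mk' (e.toLinearMap ∘ₗ D.toLinearMap ∘ₗ e.symm.toLinearMap) fun p q => ?_,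
    fun i => ?_⟩
  · simp
  · have : e.symm (linearForm (b.coord i)) = MvPolynomial.X i := by
      rw [AlgEquiv.symm_apply_eq]
      exact (MvPolynomial.aeval_X (fun i => linearForm (b.coord i)) i).symm
    change e (D (e.symm (linearForm (b.coord i)))) = c i
    rw [this, MvPolynomial.mkDerivation_X, AlgEquiv.apply_symm_apply]

variable [DecidableEq ι]

/-- Such a `D` is the derivative in the constant direction `v`; this removes the dependence on the
basis. -/
theorem derivation_linearForm (b : Module.Basis ι ℂ E) (D : Derivation ℂ (polyFun E) (polyFun E))
    (v : E) (hD : ∀ i, D (linearForm (b.coord i)) = algebraMap ℂ _ (b.coord i v))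
    (ξ : Module.Dual ℂ E) : D (linearForm ξ) = algebraMap ℂ _ (ξ v) := by
  let L : Module.Dual ℂ E →ₗ[ℂ] polyFun E :=
    { toFun := linearForm, map_add' := linearForm_add, map_smul' := linearForm_smul }
  have : D.toLinearMap ∘ₗ L = Algebra.linearMap ℂ (polyFun E) ∘ₗ Module.Dual.eval ℂ E v := by
    refine b.dualBasis.ext fun i => ?_
    rw [b.coe_dualBasis]
    exact hD i
  exact LinearMap.congr_fun this ξ

/-- With `S = ∅` nothing is transversal, and the adapted theorem becomes classical HKR. -/
theorem isAdapted_id (b : Module.Basis ι ℂ E) :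
    IsAdapted (AlgHom.id ℂ (polyFun E)) (AlgHom.id ℂ (polyFun E))
      (fun i => linearForm (b.coord i)) ∅ where
  coord := isCoordinates_coord b
  fixed _ _ := rfl
  vanish i hi := absurd hi (Finset.notMem_empty i)
  transversal := ⟨0, by simp, by simp⟩
  partials := by
    obtain ⟨d, hd⟩ := (isCoordinates_coord b).exists_partials
    exact ⟨d, fun i _ j => hd i j⟩
  splitting := ⟨AlgHom.id ℂ _, fun _ => rfl, fun _ _ => rfl⟩

end PolynomialFunctions

/-! ### Adapted coordinates from the splitting into kernel and image. -/

section FixedSpace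

variable {E : Type u} [AddCommGroup E] [Module ℂ E] [FiniteDimensional ℂ E]

/-- Injectivity on the quotient says that $(g-1)v\in\ker(g-1)$ forces $(g-1)v=0$; rank-nullity
supplies the dimensions. -/
theorem isCompl_fixedSpace_range (g : E →ₗ[ℂ] E) (hg : Function.Injective (quotientMap g)) :
    IsCompl (fixedSpace g) (LinearMap.range (g - LinearMap.id)) := by
  have hd : Disjoint (fixedSpace g) (LinearMap.range (g - LinearMap.id)) := by
    rw [Submodule.disjoint_def]
    rintro _ hv ⟨v, rfl⟩
    have h1 : quotientMap g (Submodule.Quotient.mk v) = 0 :=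
      (Submodule.Quotient.mk_eq_zero _).2 hv
    have h2 : (Submodule.Quotient.mk v : E ⧸ fixedSpace g) = 0 :=
      hg (h1.trans (map_zero _).symm)
    exact (Submodule.Quotient.mk_eq_zero _).1 h2
  refine ⟨hd, codisjoint_iff.2 (Submodule.eq_top_of_disjoint _ _ ?_ hd)⟩
  rw [add_comm, LinearMap.finrank_range_add_finrank_ker]

theorem exists_isAdapted_restriction (g : E →ₗ[ℂ] E) (hg : Function.Injective (quotientMap g)) :
    ∃ (m n : ℕ) (x : Fin m ⊕ Fin n → polyFun E) (S : Finset (Fin m ⊕ Fin n)),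
      IsAdapted (restriction g) (pullback g) x S := by
  have hc := isCompl_fixedSpace_range g hg
  set h := g - LinearMap.id with hh
  set W := fixedSpace g with hW
  set R := LinearMap.range h with hR
  have hinj : Function.Injective (h.rangeRestrict.domRestrict R) := by
    rw [← LinearMap.ker_eq_bot, LinearMap.ker_eq_bot']
    intro v hv
    have hv' : h v = 0 := congrArg Subtype.val hv
    exact Subtype.ext (Submodule.disjoint_def.1 hc.disjoint _ hv' v.2)
  let u : R ≃ₗ[ℂ] R := LinearEquiv.ofInjectiveEndo (h.rangeRestrict.domRestrict R) hinj
  have hu : ∀ v : R, (u v : E) = h v := fun v => rfl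
  let bW := Module.finBasis ℂ W
  let bV := Module.finBasis ℂ R
  -- On `R` a basis of images $h(v_i)$ is used, so that differentiating $x_j\circ h$ along $v_i$
  -- gives exactly $\delta_{ij}$.
  let b : Module.Basis (Fin _ ⊕ Fin _) ℂ E :=
    (bW.prod (bV.map u)).map (Submodule.prodEquivOfIsCompl W R hc)
  have hbl : ∀ i, b (Sum.inl i) = bW i := fun i => by simp [b]
  have hbr : ∀ i, b (Sum.inr i) = h (bV i) := fun i => by simp [b, hu]
  have cWl : ∀ (w : W) i, b.coord (Sum.inl i) w = bW.coord i w := by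
    intro w i
    refine LinearMap.congr_fun (f := b.coord (Sum.inl i) ∘ₗ W.subtype) (bW.ext fun k => ?_) w
    simp [← hbl, Finsupp.single_apply]
  have cWr : ∀ (w : W) i, b.coord (Sum.inr i) w = 0 := by
    intro w i
    refine LinearMap.congr_fun (f := b.coord (Sum.inr i) ∘ₗ W.subtype) (g := 0)
      (bW.ext fun k => ?_) w
    simp [← hbl]
  have cRl : ∀ (v : R) i, b.coord (Sum.inl i) v = 0 := by
    intro v i
    refine LinearMap.congr_fun (f := b.coord (Sum.inl i) ∘ₗ R.subtype) (g := 0)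
      ((bV.map u).ext fun k => ?_) v
    simp [hu, ← hbr]
  -- This is $u^{-1}\circ h$, the projection onto `R` along `W`; it yields the Euler identity, since
  -- $\sum_i(x_i\circ h)\,x_j(v_i)=x_j\circ F$.
  let F : E →ₗ[ℂ] E := ∑ i, (b.coord (Sum.inr i) ∘ₗ h).smulRight (bV i : E)
  have hF : ∀ e, F e = ∑ i, b.coord (Sum.inr i) (h e) • (bV i : E) := fun e => by simp [F]
  have hFR : ∀ v : R, F v = v := by
    intro v
    refine LinearMap.congr_fun (f := F ∘ₗ R.subtype) (g := R.subtype) (bV.ext fun k => ?_) v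
    simp [hF, ← hbr, Finsupp.single_apply]
  have hFW : ∀ w : W, F w = 0 := by
    intro w
    have : h w = 0 := w.2
    simp [hF, this]
  have hgh : ∀ ξ : Module.Dual ℂ E, pullback g (linearForm ξ) - linearForm ξ =
      linearForm (ξ ∘ₗ h) := by
    intro ξ
    refine Subtype.ext (funext fun v => ?_)
    change ξ (g v) - ξ v = ξ (g v - v)
    rw [map_sub]
  refine ⟨_, _, fun i => linearForm (b.coord i), Finset.univ.filter fun i => i.isRight = true,
    isCoordinates_coord b, ?_, ?_, ?_, ?_, ?_⟩
  · rintro (i | i) hi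
    · rw [← sub_eq_zero, hgh]
      refine Subtype.ext (funext fun v => ?_)
      exact cRl ⟨h v, v, rfl⟩ i
    · simp at hi
  · rintro (i | i) hi
    · simp at hi
    · exact Subtype.ext (funext fun w => cWr w i)
  · have hD : ∀ v : E, ∃ D : Derivation ℂ (polyFun E) (polyFun E),
        ∀ ξ : Module.Dual ℂ E, D (linearForm ξ) = algebraMap ℂ _ (ξ v) := by
      intro v
      obtain ⟨D, hD⟩ := (isCoordinates_coord b).exists_derivation
        fun i => algebraMap ℂ _ (b.coord i v)
      exact ⟨D, derivation_linearForm b D v hD⟩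
    choose D hD using hD
    -- Directional derivatives along the $v_i$ themselves, not along the basis vectors $h(v_i)$.
    refine ⟨Sum.elim 0 fun i => D (bV i), ?_, ?_⟩
    · rintro (i | i) j
      · simp
      · rw [hgh, Sum.elim_inr, hD, LinearMap.comp_apply, ← hbr]
        rcases eq_or_ne (Sum.inr i) j with rfl | hij
        · simp
        · simp [hij]
    · intro j
      rw [Fintype.sum_sum_type]
      simp only [Sum.elim_inl, Sum.elim_inr, Pi.zero_apply, Derivation.zero_apply, mul_zero,
        Finset.sum_const_zero, zero_add, hgh, hD]
      have e1 : ∑ i, linearForm (b.coord (Sum.inr i) ∘ₗ h) *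
          algebraMap ℂ (polyFun E) (b.coord j (bV i)) = linearForm (b.coord j ∘ₗ F) := by
        refine Subtype.ext (funext fun v => ?_)
        rw [linearForm_apply, LinearMap.comp_apply, hF, map_sum]
        simp only [map_smul, smul_eq_mul, AddSubmonoidClass.coe_finsetSum, Finset.sum_apply,
          MulMemClass.coe_mul, Pi.mul_apply, linearForm_apply]
        rfl
      rw [e1]
      have e2 : b.coord j ∘ₗ F = if j.isRight = true then b.coord j else 0 := by
        refine b.ext fun k => ?_
        rcases k with k | k
        · rw [LinearMap.comp_apply, hbl, hFW]
          rcases j with j | j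
          · simp
          · simp [cWr]
        · rw [LinearMap.comp_apply, hbr, hFR ⟨h (bV k), _, rfl⟩]
          rcases j with j | j
          · simp [cRl ⟨h (bV k), _, rfl⟩]
          · simp
      rw [e2]
      rcases j with j | j
      · simp
        rfl
      · simp
  · obtain ⟨d, hd⟩ := (isCoordinates_coord bW).exists_partials
    refine ⟨Sum.elim d 0, ?_⟩
    rintro (i | i) hi j
    · rcases j with j | j
      · have : restriction g (linearForm (b.coord (Sum.inl j))) = linearForm (bW.coord j) :=
          Subtype.ext (funext fun w => cWl w j)
        rw [this, Sum.elim_inl, hd]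
        simp
      · have : restriction g (linearForm (b.coord (Sum.inr j))) = 0 :=
          Subtype.ext (funext fun w => cWr w j)
        rw [this]
        simp
    · simp at hi
  -- The section extends a function on $E^g$ to be constant along $\mathrm{im}(g-1)$.
  · refine ⟨pullback (W.projectionOnto R hc), fun p => ?_, ?_⟩
    · refine Subtype.ext (funext fun w => ?_)
      change (p : W → ℂ) (W.projectionOnto R hc w) = (p : W → ℂ) w
      rw [Submodule.projectionOnto_apply_left]
    · rintro (i | i) hi
      · refine Subtype.ext (funext fun v => ?_)
        change b.coord (Sum.inl i) (W.projectionOnto R hc v : E) = b.coord (Sum.inl i) v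
        refine LinearMap.congr_fun (f := b.coord (Sum.inl i) ∘ₗ W.subtype ∘ₗ
          W.projectionOnto R hc) (b.ext fun k => ?_) v
        rcases k with k | k
        · simp [hbl, Submodule.projectionOnto_apply_left]
        · have : h (bV k) ∈ R := ⟨_, rfl⟩
          have h2 := cRl ⟨_, this⟩ i
          simp only [LinearMap.comp_apply, hbr]
          rw [h2, (Submodule.projectionOnto_apply_eq_zero_iff hc).2 this]
          simp
      · simp at hi

end FixedSpace

end

end TwistedHochschild

theorem mainTheorem9 {E : Type*} [AddCommGroup E] [Module ℂ E] [FiniteDimensional ℂ E]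
    (g : E →ₗ[ℂ] E) (hg : Function.Injective (TwistedHochschild.quotientMap g)) (q : ℕ) :
    CategoryTheory.IsIso (TwistedHochschild.resHH g q) ∧
    CategoryTheory.IsIso
      (TwistedHochschild.chiUntwisted (TwistedHochschild.fixedSpace g) q) ∧
    CategoryTheory.CategoryStruct.comp (TwistedHochschild.resHH g q)
      (TwistedHochschild.chiUntwisted (TwistedHochschild.fixedSpace g) q) =
        TwistedHochschild.chiTwisted g q ∧
    CategoryTheory.IsIso (TwistedHochschild.chiTwisted g q) := by
  have hcomp := TwistedHochschild.mapHH_comp_chi (TwistedHochschild.restriction g)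
    (TwistedHochschild.pullback g) (TwistedHochschild.restriction_comp g)
    ((TwistedHochschild.restriction_comp g).trans (AlgHom.id_comp _).symm) q
  obtain ⟨m, n, x, S, hx⟩ := TwistedHochschild.exists_isAdapted_restriction g hg
  have htw : CategoryTheory.IsIso (TwistedHochschild.chiTwisted g q) :=
    hx.isIso_chi (TwistedHochschild.restriction_comp g) q
  have hun : CategoryTheory.IsIso
      (TwistedHochschild.chiUntwisted (TwistedHochschild.fixedSpace g) q) :=
    (TwistedHochschild.isAdapted_id
      (Module.finBasis ℂ (TwistedHochschild.fixedSpace g))).isIso_chi (AlgHom.id_comp _) q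
  have hres : CategoryTheory.CategoryStruct.comp (TwistedHochschild.resHH g q)
      (TwistedHochschild.chiUntwisted (TwistedHochschild.fixedSpace g) q) =
        TwistedHochschild.chiTwisted g q := hcomp
  refine ⟨?_, hun, hres, htw⟩
  rw [← hres] at htw
  exact CategoryTheory.IsIso.of_isIso_comp_right (TwistedHochschild.resHH g q)
    (TwistedHochschild.chiUntwisted (TwistedHochschild.fixedSpace g) q)
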